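/- Let $A,B,C,D$ be independent $N(0,1)$ random variables on a probability space with probability measure $P$, and consider the random linear planar vector field $$F=(Ax+By)\,\frac{\partial}{\partial x}+(Cx+Dy)\,\frac{\partial}{\partial y}.$$ The Poincaré compactification of a linear vector field $f$ is the vector field $u\mapsto f(u)-\langle u,f(u)\rangle u$ on the closed unit disk. It is the image of $f$ under $x\mapsto x/\sqrt{1+\|x\|^2}$, extended to the circle at infinity $\|u\|=1$. Two linear vector fields have the same phase portrait modulo time orientation if there is a homeomorphism of the closed disk that preserves the circle at infinity and carries the orbits of one compactification onto the orbits of the other, either preserving the sense of all orbits or reversing the sense of all of them. Let $L_1$ (saddle), $L_2$ (node), $L_3$ (focus) be the phase portraits, in this sense, of the vector fields $(x,-y)$, $(-x,-2y)$, $(-x-y,\,x-y)$, respectively. For a linear vector field $f$ with an isolated zero at the origin let $i$ be its index there, that is, the degree of $f/\|f\|$ on a small circle around the origin, and let $l$ be the number of straight lines through the origin that are invariant by the flow of $f$. (a) The phase portraits $L_1,L_2,L_3$ are pairwise different, and they are exactly the phase portraits, modulo time orientation, that $F$ has with positive probability. (b) They are completely determined by the couple $(i,l)$: two linear vector fields with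 phase portraits of positive probability have the same phase portrait modulo time orientation if and only if they have the same couple $(i,l)$. The couples of $L_1,L_2,L_3$ are $(-1,2)$, $(1,2)$ and $(1,0)$, respectively. (c) $P(L_1)=\tfrac12$, $P(L_2)=\tfrac{\sqrt2}{2}-\tfrac12$ and $P(L_3)=1-\tfrac{\sqrt2}{2}$, where $P(L_j)$ is the probability that $F$ has the phase portrait $L_j$, modulo time orientation. (d) The probability that the origin is a global attractor of $F$ (all solutions tend to the origin as $t\to+\infty$) is $\tfrac14$, and the probability that it is a global repeller (all solutions tend to the origin as $t\to-\infty$) is $\tfrac14$. -/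

import Mathlib

open MeasureTheory ProbabilityTheory Filter Topology

/-- The Euclidean plane. -/
abbrev Plane : Type := EuclideanSpace ℝ (Fin 2)

/-- The closed unit disk, carrier of the Poincaré compactification of the plane. -/
abbrev PoincareDisk : Type := Metric.closedBall (0 : Plane) 1

/-- The linear vector field
`(c₀₀ x + c₀₁ y) ∂/∂x + (c₁₀ x + c₁₁ y) ∂/∂y`. -/
def linearField (c : Matrix (Fin 2) (Fin 2) ℝ) : Plane → Plane :=
  fun p => !₂[c 0 0 * p 0 + c 0 1 * p 1, c 1 0 * p 0 + c 1 1 * p 1]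

/-- `γ` is a solution, defined for all times, of the autonomous system `γ' = f(γ)`. -/
def IsSolution (f : Plane → Plane) (γ : ℝ → Plane) : Prop :=
  ∀ t : ℝ, HasDerivAt γ (f (γ t)) t

/-! ### Phase portraits on the Poincaré disk -/

/-- The central projection `x ↦ x / √(1 + ‖x‖²)` of the plane onto the open unit disk (central
projection to the upper hemisphere followed by orthogonal projection). -/
noncomputable def centralProj (x : Plane) : Plane :=
  (√(1 + ‖x‖ ^ 2))⁻¹ • x

/-- The Poincaré compactification of a homogeneous planar vector field `f`, as a vector field on
the closed unit disk: `u ↦ f(u) - ⟨u, f(u)⟩ u`. With `w = √(1 + ‖x‖²)` and `u = x / w`, the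
system `x' = f(x)`, `f` homogeneous of degree `n`, becomes
`u' = w ^ (n - 1) (f(u) - ⟨u, f(u)⟩ u)`; one drops the positive factor `w ^ (n - 1)`, which is `1`
for linear fields, and extends the formula to the circle at infinity `‖u‖ = 1`. -/
noncomputable def poincareField (f : Plane → Plane) : Plane → Plane :=
  fun u => f u - (inner ℝ u (f u)) • u

/-- For a field that is homogeneous of degree one, the central projection carries solutions in the
plane to solutions of the compactified field. -/
theorem IsSolution.centralProj_comp {f : Plane → Plane} (hf : ∀ (r : ℝ) (p : Plane), f (r • p) = r • f p)
    {γ : ℝ → Plane} (hγ : IsSolution f γ) :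
    IsSolution (poincareField f) (fun t => centralProj (γ t)) := by
  intro t
  have h1 : HasDerivAt (fun s => 1 + ‖γ s‖ ^ 2) (2 * inner ℝ (γ t) (f (γ t))) t := by
    simpa using (hγ t).norm_sq.const_add 1
  have hpos : 0 < 1 + ‖γ t‖ ^ 2 := by positivity
  have h2 := ((h1.sqrt hpos.ne').inv (Real.sqrt_ne_zero'.2 hpos)).smul (hγ t)
  refine h2.congr_deriv ?_
  have hw : √(1 + ‖γ t‖ ^ 2) ≠ 0 := Real.sqrt_ne_zero'.2 hpos
  simp only [poincareField, centralProj, hf, inner_smul_left, inner_smul_right, smul_smul,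
    Pi.inv_apply]
  rw [sub_eq_add_neg, ← neg_smul]
  congr 2
  simp only [RCLike.conj_to_real]
  field_simp

/-- Topological equivalence, preserving the sense of all orbits, of two compactified homogeneous
vector fields: a homeomorphism of the Poincaré disk that preserves the circle at infinity and
carries each orbit of the first onto an orbit of the second, with its orientation. -/
def OrientedEquivalent (f g : Plane → Plane) : Prop :=
  ∃ h : PoincareDisk ≃ₜ PoincareDisk,
    (∀ u : PoincareDisk, ‖(u : Plane)‖ = 1 ↔ ‖(h u : Plane)‖ = 1) ∧
    ∀ γ : ℝ → PoincareDisk, IsSolution (poincareField f) (fun t => (γ t : Plane)) →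
      ∃ δ : ℝ → PoincareDisk, IsSolution (poincareField g) (fun t => (δ t : Plane)) ∧
        ∃ σ : ℝ ≃o ℝ, ∀ t : ℝ, h (γ t) = δ (σ t)

/-- `f` and `g` have the same phase portrait on the Poincaré disk, modulo time orientation: the
sense of all orbits is preserved, or it is reversed simultaneously on all orbits. -/
def SamePortrait (f g : Plane → Plane) : Prop :=
  OrientedEquivalent f g ∨ OrientedEquivalent f (-g)

/-- The names of the three phase portraits. -/
inductive LinearPortrait : Type
  | saddle
  | node
  | focus

/-- Concrete linear systems with these portraits: the saddle `(x, -y)`, the node `(-x, -2y)`, and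
the focus `(-x - y, x - y)`. -/
def LinearPortrait.model : LinearPortrait → Matrix (Fin 2) (Fin 2) ℝ
  | .saddle => !![1, 0; 0, -1]
  | .node => !![-1, 0; 0, -2]
  | .focus => !![-1, -1; 1, -1]

/-- The field `f` has the phase portrait `L`, modulo time orientation. -/
def HasPortrait (f : Plane → Plane) (L : LinearPortrait) : Prop :=
  SamePortrait f (linearField L.model)

/-! ### Index, invariant lines, attractors -/

/-- The origin is an isolated zero of `f`, and the index of `f` there is `k`: on some circle of
radius `ε` bounding a closed ball that contains no other zero, the map `f / ‖f‖` has degree `k`,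
that is, a continuous determination `φ` of its angle increases by `2πk` in one turn. -/
def HasIndex (f : Plane → Plane) (k : ℤ) : Prop :=
  ∃ ε : ℝ, 0 < ε ∧ (∀ p : Plane, ‖p‖ ≤ ε → (f p = 0 ↔ p = 0)) ∧
    ∃ φ : ℝ → ℝ, Continuous φ ∧
      (∀ t : ℝ, f !₂[ε * Real.cos t, ε * Real.sin t] =
        ‖f !₂[ε * Real.cos t, ε * Real.sin t]‖ • !₂[Real.cos (φ t), Real.sin (φ t)]) ∧
      φ (2 * Real.pi) = φ 0 + 2 * Real.pi * k

/-- The straight lines through the origin that are invariant by the flow of `f`. -/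
def invariantLines (f : Plane → Plane) : Set (Submodule ℝ Plane) :=
  {L | Module.finrank ℝ L = 1 ∧
    ∀ γ : ℝ → Plane, IsSolution f γ → γ 0 ∈ L → ∀ t : ℝ, γ t ∈ L}

/-- The couple (index, number of invariant lines) of `f` is `(i, l)`. -/
def HasCouple (f : Plane → Plane) (i : ℤ) (l : ℕ) : Prop :=
  HasIndex f i ∧ (invariantLines f).encard = l

/-- The origin is a global attractor: all solutions tend to it as `t → +∞`. -/
def IsGlobalAttractor (f : Plane → Plane) : Prop :=
  ∀ γ : ℝ → Plane, IsSolution f γ → Tendsto γ atTop (𝓝 0)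

/-- The origin is a global repeller: all solutions tend to it as `t → -∞`. -/
def IsGlobalRepeller (f : Plane → Plane) : Prop :=
  ∀ γ : ℝ → Plane, IsSolution f γ → Tendsto γ atBot (𝓝 0)

/-! ### Random linear fields -/

/-- The linear field whose coefficients are the values at `ω` of the random variables `X i j`. -/
def randomField {Ω : Type*} (X : Fin 2 → Fin 2 → Ω → ℝ) (ω : Ω) : Plane → Plane :=
  linearField (Matrix.of fun i j => X i j ω)

/-- The phase portrait of `f`, modulo time orientation, has positive probability for the random
linear field with coefficients `X i j`. -/
def PositiveProbability {Ω : Type*} [MeasurableSpace Ω] (P : Measure Ω)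
    (X : Fin 2 → Fin 2 → Ω → ℝ) (f : Plane → Plane) : Prop :=
  0 < P {ω | SamePortrait (randomField X ω) f}

/-! The portrait is decided by the determinant, the trace and the discriminant tr² - 4 det of the
matrix. Outside the null set where one of these vanishes, there are three regions: det < 0; det > 0
and disc > 0; disc < 0 (`exists_realizes`). Up to that null set these are the sets
`LinearPortrait.Realizes`, and `hasPortrait_iff` identifies them with the three portraits.

Each region carries one portrait. In homogeneous coordinates (x, z), z ≥ 0, the compactified flow is
x' = cx, z' = 0 modulo positive factors, so maps of the half space that respect rays induce maps of
the disk (`orientedEquivalent_of_isConeMap`). Linear conjugation reduces to diagonal or spiral form.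
For diagonal fields, raising the coordinates to different powers on the sup-norm sphere, with a
change of time, moves the rates (a, b, 0) to those of the model (`orientedEquivalent_diag`). For
foci, a power of the radius adjusts the ratio of decay to rotation. Time reversal takes care of
positive traces.

Different regions carry different portraits. An equivalence maps zeros to zeros and infinity to
infinity, so it detects whether the matrix is singular, whether disc ≥ 0 (there are zeros at
infinity) and whether disc > 0 (at least three such zeros, but not the whole circle). It also
preserves the property that the centre attracts, or repels, all interior orbits, which means det > 0
and tr ≠ 0 when det and disc are nonzero. Together these recover the region
(`LinearPortrait.Realizes.of_samePortrait`). The index is the sign of the determinant and the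
invariant lines are the eigenlines, so the couple (i, l) carries the same information.

The probabilities come from the invariance of the standard Gaussian measure under isometries.
Exchanging the rows flips the sign of det, so P(det < 0) = 1/2. In the orthonormal coordinates (A ±
D)/√2, (B ± C)/√2 the discriminant is 2(U² + V² - W²), and U² + V² has tail exp(-s/2), so P(disc >
0) = E exp(-W²/2) = √2/2. Since det < 0 forces disc > 0, nodes have the difference of these
probabilities and foci the complement of the second. The symmetry X ↦ -X halves {det > 0} into
attractors and repellers. -/

/-! ### Linear systems in the plane -/

/-- The linear field with matrix `c`, as a continuous linear map. -/
noncomputable def linearFieldCLM (c : Matrix (Fin 2) (Fin 2) ℝ) : Plane →L[ℝ] Plane :=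
  LinearMap.toContinuousLinearMap
    { toFun := linearField c
      map_add' := fun x y => by ext i; fin_cases i <;> simp [linearField] <;> ring
      map_smul' := fun r x => by ext i; fin_cases i <;> simp [linearField] <;> ring }

@[simp]
lemma linearFieldCLM_apply (c : Matrix (Fin 2) (Fin 2) ℝ) (x : Plane) :
    linearFieldCLM c x = linearField c x := rfl

lemma linearField_smul (c : Matrix (Fin 2) (Fin 2) ℝ) (r : ℝ) (x : Plane) :
    linearField c (r • x) = r • linearField c x :=
  (linearFieldCLM c).map_smul r x

@[simp]
lemma linearField_zero (c : Matrix (Fin 2) (Fin 2) ℝ) : linearField c 0 = 0 :=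
  (linearFieldCLM c).map_zero

lemma linearField_neg (c : Matrix (Fin 2) (Fin 2) ℝ) : linearField (-c) = -linearField c := by
  funext x
  ext i
  fin_cases i <;> simp [linearField] <;> ring

lemma linearField_mul (c d : Matrix (Fin 2) (Fin 2) ℝ) (x : Plane) :
    linearField (c * d) x = linearField c (linearField d x) := by
  ext i
  fin_cases i <;> simp [linearField, Matrix.mul_apply] <;> ring

@[simp]
lemma linearField_one (x : Plane) : linearField 1 x = x := by
  ext i
  fin_cases i <;> simp [linearField]

lemma continuous_linearField (c : Matrix (Fin 2) (Fin 2) ℝ) : Continuous (linearField c) :=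
  (linearFieldCLM c).continuous

lemma norm_sq_plane (x : Plane) : ‖x‖ ^ 2 = x 0 ^ 2 + x 1 ^ 2 := by
  simp [EuclideanSpace.real_norm_sq_eq]

lemma plane_ext {x y : Plane} (h0 : x 0 = y 0) (h1 : x 1 = y 1) : x = y := by
  ext i
  fin_cases i
  · exact h0
  · exact h1

lemma hasDerivAt_plane {γ : ℝ → Plane} {v : Plane} {t : ℝ}
    (h0 : HasDerivAt (fun s => γ s 0) (v 0) t) (h1 : HasDerivAt (fun s => γ s 1) (v 1) t) :
    HasDerivAt γ v t := by
  have h : HasDerivAt (fun s => WithLp.ofLp (γ s)) (WithLp.ofLp v) t := by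
    rw [hasDerivAt_pi]
    intro i
    fin_cases i
    · exact h0
    · exact h1
  exact ((PiLp.continuousLinearEquiv 2 ℝ (fun _ : Fin 2 => ℝ)).symm.hasFDerivAt.comp_hasDerivAt t h)

lemma IsSolution.eq_of_eq {c : Matrix (Fin 2) (Fin 2) ℝ} {γ δ : ℝ → Plane}
    (hγ : IsSolution (linearField c) γ) (hδ : IsSolution (linearField c) δ) {t₀ : ℝ}
    (h : γ t₀ = δ t₀) : γ = δ :=
  ODE_solution_unique_univ (v := fun _ => linearField c) (s := fun _ => Set.univ)
    (fun _ => ((linearFieldCLM c).lipschitz.lipschitzOnWith))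
    (fun t => ⟨hγ t, trivial⟩) (fun t => ⟨hδ t, trivial⟩) h

lemma exists_isSolution_linearField (c : Matrix (Fin 2) (Fin 2) ℝ) (x : Plane) :
    ∃ η : ℝ → Plane, IsSolution (linearField c) η ∧ η 0 = x := by
  refine ⟨fun t => NormedSpace.exp (t • linearFieldCLM c) x, fun t => ?_, ?_⟩
  swap
  · have h : NormedSpace.exp ((0 : ℝ) • linearFieldCLM c) = 1 := by
      have h0 : (0 : ℝ) • linearFieldCLM c = 0 := zero_smul ℝ (linearFieldCLM c)
      exact (congrArg NormedSpace.exp h0).trans NormedSpace.exp_zero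
    exact congrArg (fun L : Plane →L[ℝ] Plane => L x) h
  exact (hasDerivAt_exp_smul_const' (𝕂 := ℝ) (linearFieldCLM c) t).clm_apply
    (hasDerivAt_const t x) |>.congr_deriv (by simp)

lemma isSolution_zero (c : Matrix (Fin 2) (Fin 2) ℝ) : IsSolution (linearField c) (fun _ => 0) :=
  fun t => by simpa using hasDerivAt_const t (0 : Plane)

lemma IsSolution.ne_zero {c : Matrix (Fin 2) (Fin 2) ℝ} {η : ℝ → Plane}
    (hη : IsSolution (linearField c) η) (h : η 0 ≠ 0) (t : ℝ) : η t ≠ 0 := by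
  intro ht
  exact h (congrFun (hη.eq_of_eq (isSolution_zero c) ht) 0)

lemma IsSolution.comp_neg {f : Plane → Plane} {γ : ℝ → Plane} (hγ : IsSolution f γ) :
    IsSolution (-f) (fun t => γ (-t)) := by
  intro t
  exact (HasDerivAt.scomp t (hγ (-t)) (hasDerivAt_neg t)).congr_deriv (by simp)

lemma IsSolution.comp_add {f : Plane → Plane} {γ : ℝ → Plane} (hγ : IsSolution f γ) (a : ℝ) :
    IsSolution f (fun t => γ (t + a)) :=
  fun t => (hγ (t + a)).comp_add_const t a

lemma IsSolution.linear_comp {c d T : Matrix (Fin 2) (Fin 2) ℝ} (hT : d * T = T * c)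
    {γ : ℝ → Plane} (hγ : IsSolution (linearField c) γ) :
    IsSolution (linearField d) (fun t => linearField T (γ t)) := by
  intro t
  have := (linearFieldCLM T).hasFDerivAt.comp_hasDerivAt t (hγ t)
  refine this.congr_deriv ?_
  rw [linearFieldCLM_apply, ← linearField_mul, ← hT, linearField_mul]

/-! ### The Poincaré compactification in homogeneous coordinates -/

/-- The point of the closed disk with homogeneous coordinates `(x, z)`, `z ≥ 0`. -/
noncomputable def compactify (x : Plane) (z : ℝ) : Plane := (√(‖x‖ ^ 2 + z ^ 2))⁻¹ • x

/-- The height of the point of the upper hemisphere above the point `u` of the disk. -/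
noncomputable def height (u : Plane) : ℝ := √(1 - ‖u‖ ^ 2)

lemma height_nonneg (u : Plane) : 0 ≤ height u := Real.sqrt_nonneg _

lemma height_sq {u : Plane} (hu : ‖u‖ ≤ 1) : height u ^ 2 = 1 - ‖u‖ ^ 2 :=
  Real.sq_sqrt (by nlinarith [norm_nonneg u])

lemma height_eq_zero_iff {u : Plane} (hu : ‖u‖ ≤ 1) : height u = 0 ↔ ‖u‖ = 1 := by
  have h := height_sq hu
  constructor
  · intro h0
    rw [h0] at h
    nlinarith [norm_nonneg u]
  · intro h1
    rw [h1] at h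
    simpa using h

lemma height_ne {u : Plane} (hu : ‖u‖ ≤ 1) : u ≠ 0 ∨ height u ≠ 0 := by
  by_contra! h
  have := height_sq hu
  rw [h.2, h.1] at this
  simp at this

lemma continuous_height : Continuous height := by unfold height; fun_prop

lemma compactify_den_pos {x : Plane} {z : ℝ} (h : x ≠ 0 ∨ z ≠ 0) : 0 < ‖x‖ ^ 2 + z ^ 2 := by
  rcases h with h | h
  · have := norm_pos_iff.2 h
    positivity
  · positivity

lemma compactify_smul {r : ℝ} (hr : 0 < r) (x : Plane) (z : ℝ) :
    compactify (r • x) (r * z) = compactify x z := by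
  have : ‖r • x‖ ^ 2 + (r * z) ^ 2 = r ^ 2 * (‖x‖ ^ 2 + z ^ 2) := by
    rw [norm_smul, mul_pow, Real.norm_eq_abs, sq_abs]
    ring
  rw [compactify, this, Real.sqrt_mul (by positivity), Real.sqrt_sq hr.le, smul_smul, compactify,
    mul_inv, mul_right_comm, inv_mul_cancel₀ hr.ne', one_mul]

lemma compactify_height {u : Plane} (hu : ‖u‖ ≤ 1) : compactify u (height u) = u := by
  simp [compactify, height_sq hu]

lemma norm_sq_compactify {x : Plane} {z : ℝ} (h : x ≠ 0 ∨ z ≠ 0) :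
    ‖compactify x z‖ ^ 2 = ‖x‖ ^ 2 / (‖x‖ ^ 2 + z ^ 2) := by
  rw [compactify, norm_smul, mul_pow, norm_inv, Real.norm_eq_abs, inv_pow, sq_abs,
    Real.sq_sqrt (compactify_den_pos h).le]
  ring

lemma norm_compactify_le (x : Plane) (z : ℝ) : ‖compactify x z‖ ≤ 1 := by
  by_cases h : x ≠ 0 ∨ z ≠ 0
  · have h1 := norm_sq_compactify h
    have h2 : ‖x‖ ^ 2 / (‖x‖ ^ 2 + z ^ 2) ≤ 1 :=
      (div_le_one (compactify_den_pos h)).2 (by nlinarith [sq_nonneg z])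
    nlinarith [norm_nonneg (compactify x z)]
  · push Not at h
    simp [compactify, h.1]

lemma norm_compactify_eq_one_iff {x : Plane} {z : ℝ} (h : x ≠ 0 ∨ z ≠ 0) :
    ‖compactify x z‖ = 1 ↔ z = 0 := by
  have h1 := norm_sq_compactify h
  have h2 := compactify_den_pos h
  constructor
  · intro h3
    rw [h3, eq_comm, one_pow, div_eq_one_iff_eq h2.ne'] at h1
    simpa using h1
  · rintro rfl
    rw [div_eq_one_iff_eq h2.ne' |>.2 (by ring)] at h1
    nlinarith [norm_nonneg (compactify x 0)]

lemma height_compactify {x : Plane} {z : ℝ} (hz : 0 ≤ z) (h : x ≠ 0 ∨ z ≠ 0) :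
    height (compactify x z) = (√(‖x‖ ^ 2 + z ^ 2))⁻¹ * z := by
  have h2 := compactify_den_pos h
  have h1 : 1 - ‖compactify x z‖ ^ 2 = z ^ 2 / (‖x‖ ^ 2 + z ^ 2) := by
    rw [norm_sq_compactify h]
    field_simp
    ring
  rw [height, h1, Real.sqrt_div (sq_nonneg z), Real.sqrt_sq hz, div_eq_inv_mul]

lemma continuousOn_compactify :
    ContinuousOn (fun p : Plane × ℝ => compactify p.1 p.2) {p | p.1 ≠ 0 ∨ p.2 ≠ 0} := by
  unfold compactify
  have h1 : Continuous fun p : Plane × ℝ => √(‖p.1‖ ^ 2 + p.2 ^ 2) := by fun_prop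
  refine ContinuousOn.smul (h1.continuousOn.inv₀ fun p hp => ?_) continuous_fst.continuousOn
  exact (Real.sqrt_pos.2 (compactify_den_pos hp)).ne'

/-- The lifted system x' = cx, z' = 0 is linear, and the normalisation projects it to the disk. The
value z = 1 is the central projection; z = 0 gives the flow on the circle at infinity. -/
lemma IsSolution.compactify {c : Matrix (Fin 2) (Fin 2) ℝ} {η : ℝ → Plane}
    (hη : IsSolution (linearField c) η) {z : ℝ} (h : η 0 ≠ 0 ∨ z ≠ 0) :
    IsSolution (poincareField (linearField c)) (fun t => compactify (η t) z) := by
  intro t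
  have hne : η t ≠ 0 ∨ z ≠ 0 := h.imp_left fun h => hη.ne_zero h t
  have hpos := compactify_den_pos hne
  have h1 : HasDerivAt (fun s => ‖η s‖ ^ 2 + z ^ 2) (2 * inner ℝ (η t) (linearField c (η t))) t :=
    (hη t).norm_sq.add_const (z ^ 2)
  have h2 := ((h1.sqrt hpos.ne').inv (Real.sqrt_ne_zero'.2 hpos)).smul (hη t)
  refine h2.congr_deriv ?_
  have hw : √(‖η t‖ ^ 2 + z ^ 2) ≠ 0 := Real.sqrt_ne_zero'.2 hpos
  simp only [poincareField, _root_.compactify, linearField_smul, inner_smul_left,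
    inner_smul_right, smul_smul, Pi.inv_apply]
  rw [sub_eq_add_neg, ← neg_smul]
  congr 2
  simp only [RCLike.conj_to_real]
  field_simp

/-- The compactified field is not linear, but it is C¹ on a compact convex set; this suffices for
uniqueness of solutions in the disk. -/
lemma exists_lipschitzOnWith_poincareField (c : Matrix (Fin 2) (Fin 2) ℝ) :
    ∃ K, LipschitzOnWith K (poincareField (linearField c)) (Metric.closedBall 0 1) := by
  refine ContDiffOn.exists_lipschitzOnWith (n := 1) ?_ (by simp) (convex_closedBall _ _)
    (isCompact_closedBall _ _)
  have h : ContDiff ℝ 1 (linearField c) := (linearFieldCLM c).contDiff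
  exact (h.sub ((contDiff_id.inner ℝ h).smul contDiff_id)).contDiffOn

lemma IsSolution.disk_eq_of_eq {c : Matrix (Fin 2) (Fin 2) ℝ} {γ δ : ℝ → PoincareDisk}
    (hγ : IsSolution (poincareField (linearField c)) (fun t => (γ t : Plane)))
    (hδ : IsSolution (poincareField (linearField c)) (fun t => (δ t : Plane))) {t₀ : ℝ}
    (h : γ t₀ = δ t₀) : γ = δ := by
  obtain ⟨K, hK⟩ := exists_lipschitzOnWith_poincareField c
  have := ODE_solution_unique_univ (v := fun _ => poincareField (linearField c))
    (s := fun _ => Metric.closedBall 0 1) (fun _ => hK)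
    (fun t => ⟨hγ t, (γ t).2⟩) (fun t => ⟨hδ t, (δ t).2⟩) (congrArg Subtype.val h)
  funext t
  exact Subtype.ext (congrFun this t)

lemma PoincareDisk.norm_le (u : PoincareDisk) : ‖(u : Plane)‖ ≤ 1 :=
  mem_closedBall_zero_iff.1 u.2

/-- The point of the Poincaré disk with homogeneous coordinates `(x, z)`. -/
noncomputable def diskPoint (x : Plane) (z : ℝ) : PoincareDisk :=
  ⟨compactify x z, mem_closedBall_zero_iff.2 (norm_compactify_le x z)⟩

@[simp]
lemma coe_diskPoint (x : Plane) (z : ℝ) : (diskPoint x z : Plane) = compactify x z := rfl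

lemma diskPoint_height (u : PoincareDisk) : diskPoint u (height u) = u :=
  Subtype.ext (compactify_height u.norm_le)

lemma diskPoint_smul {r : ℝ} (hr : 0 < r) (x : Plane) (z : ℝ) :
    diskPoint (r • x) (r * z) = diskPoint x z :=
  Subtype.ext (compactify_smul hr x z)

/-- Completeness of the flow on the disk is inherited from the linear lift. It lets statements about
orbits be turned into statements about points. -/
lemma exists_disk_solution (c : Matrix (Fin 2) (Fin 2) ℝ) (u : PoincareDisk) :
    ∃ γ : ℝ → PoincareDisk, IsSolution (poincareField (linearField c)) (fun t => (γ t : Plane)) ∧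
      γ 0 = u := by
  obtain ⟨η, hη, h0⟩ := exists_isSolution_linearField c u
  refine ⟨fun t => diskPoint (η t) (height u), ?_, ?_⟩
  · exact hη.compactify (by rw [h0]; exact height_ne u.norm_le)
  · simp only [h0]
    exact diskPoint_height u

/-- Solutions in the disk are the images of the solutions in the plane. -/
lemma IsSolution.eq_diskPoint {c : Matrix (Fin 2) (Fin 2) ℝ} {γ : ℝ → PoincareDisk}
    (hγ : IsSolution (poincareField (linearField c)) (fun t => (γ t : Plane)))
    {η : ℝ → Plane} (hη : IsSolution (linearField c) η) (h : η 0 = γ 0) (t : ℝ) :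
    γ t = diskPoint (η t) (height (γ 0)) := by
  have h1 : IsSolution (poincareField (linearField c))
      (fun t => (diskPoint (η t) (height (γ 0)) : Plane)) :=
    hη.compactify (by rw [h]; exact height_ne (γ 0).norm_le)
  refine congrFun (hγ.disk_eq_of_eq h1 (t₀ := 0) ?_) t
  simp only [h]
  exact (diskPoint_height (γ 0)).symm

/-! ### Topological equivalence of compactified linear fields -/

lemma OrientedEquivalent.trans {f g k : Plane → Plane} (hfg : OrientedEquivalent f g)
    (hgk : OrientedEquivalent g k) : OrientedEquivalent f k := by
  obtain ⟨h, hn, ho⟩ := hfg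
  obtain ⟨h', hn', ho'⟩ := hgk
  refine ⟨h.trans h', fun u => (hn u).trans (hn' (h u)), fun γ hγ => ?_⟩
  obtain ⟨δ, hδ, σ, hσ⟩ := ho γ hγ
  obtain ⟨ε, hε, τ, hτ⟩ := ho' δ hδ
  exact ⟨ε, hε, σ.trans τ, fun t => by simp [hσ, hτ]⟩

/-- The definition only sends orbits of the first field to orbits of the second. Existence and
uniqueness of complete solutions make every orbit of the second the image of one of the first. -/
lemma OrientedEquivalent.symm {c d : Matrix (Fin 2) (Fin 2) ℝ}
    (h : OrientedEquivalent (linearField c) (linearField d)) :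
    OrientedEquivalent (linearField d) (linearField c) := by
  obtain ⟨h, hn, ho⟩ := h
  refine ⟨h.symm, fun u => by rw [hn (h.symm u), h.apply_symm_apply], fun δ hδ => ?_⟩
  obtain ⟨γ, hγ, h0⟩ := exists_disk_solution c (h.symm (δ 0))
  obtain ⟨δ', hδ', σ, hσ⟩ := ho γ hγ
  -- The image orbit passes through `δ 0` at time `σ 0`, so by uniqueness it is `δ` up to a shift of
  -- time.
  have key : δ = fun t => δ' (t + σ 0) := by
    refine hδ.disk_eq_of_eq (t₀ := 0) (hδ'.comp_add (σ 0)) ?_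
    rw [zero_add, ← hσ 0, h0, h.apply_symm_apply]
  refine ⟨γ, hγ, (OrderIso.addRight (σ 0)).trans σ.symm, fun t => ?_⟩
  rw [h.symm_apply_eq, hσ, key]
  simp

lemma poincareField_neg (f : Plane → Plane) : poincareField (-f) = -poincareField f := by
  funext u
  simp [poincareField, inner_neg_right]
  abel

/-- Reversal of the time, as an order isomorphism of `ℝ` after conjugation. -/
def reverseOrderIso (σ : ℝ ≃o ℝ) : ℝ ≃o ℝ where
  toFun t := -σ (-t)
  invFun t := -σ.symm (-t)
  left_inv t := by simp
  right_inv t := by simp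
  map_rel_iff' := by intro a b; simp

/-- The same homeomorphism works: time is reversed on both sides, and σ is conjugated by t ↦ -t,
hence stays increasing. -/
lemma OrientedEquivalent.neg {f g : Plane → Plane} (h : OrientedEquivalent f g) :
    OrientedEquivalent (-f) (-g) := by
  obtain ⟨h, hn, ho⟩ := h
  refine ⟨h, hn, fun γ hγ => ?_⟩
  have h1 := hγ.comp_neg
  rw [← poincareField_neg, neg_neg] at h1
  obtain ⟨δ, hδ, σ, hσ⟩ := ho (fun t => γ (-t)) h1
  have h2 := hδ.comp_neg
  rw [← poincareField_neg] at h2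
  refine ⟨fun t => δ (-t), h2, reverseOrderIso σ, fun t => ?_⟩
  simpa [reverseOrderIso] using hσ (-t)

lemma SamePortrait.symm {c d : Matrix (Fin 2) (Fin 2) ℝ}
    (h : SamePortrait (linearField c) (linearField d)) :
    SamePortrait (linearField d) (linearField c) := by
  rcases h with h | h
  · exact Or.inl h.symm
  · refine Or.inr ?_
    rw [← linearField_neg] at h
    have := h.symm.neg
    rwa [linearField_neg, neg_neg] at this

lemma SamePortrait.trans {f g k : Plane → Plane} (hfg : SamePortrait f g)
    (hgk : SamePortrait g k) : SamePortrait f k := by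
  rcases hfg with h | h <;> rcases hgk with h' | h'
  · exact Or.inl (h.trans h')
  · exact Or.inr (h.trans h')
  · exact Or.inr (h.trans h'.neg)
  · refine Or.inl (h.trans ?_)
    simpa using h'.neg

/-! ### Equivalences induced by maps of the half space. -/

/-- The half space `z ≥ 0` without the origin. -/
def halfCone : Set (Plane × ℝ) := {p | (p.1 ≠ 0 ∨ p.2 ≠ 0) ∧ 0 ≤ p.2}

lemma smul_mem_halfCone {p : Plane × ℝ} (hp : p ∈ halfCone) {r : ℝ} (hr : 0 < r) :
    r • p ∈ halfCone := by
  refine ⟨hp.1.imp (fun h => ?_) (fun h => ?_), mul_nonneg hr.le hp.2⟩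
  · exact smul_ne_zero hr.ne' h
  · exact mul_ne_zero hr.ne' h

/-- Maps of the half space that induce continuous self-maps of the Poincaré disk. -/
structure IsConeMap (Ψ : Plane × ℝ → Plane × ℝ) : Prop where
  continuousOn : ContinuousOn Ψ halfCone
  mapsTo : Set.MapsTo Ψ halfCone halfCone
  snd_eq_zero_iff : ∀ p ∈ halfCone, (Ψ p).2 = 0 ↔ p.2 = 0
  map_smul : ∀ p ∈ halfCone, ∀ r : ℝ, 0 < r → ∃ s : ℝ, 0 < s ∧ Ψ (r • p) = s • Ψ p

lemma mk_height_mem (u : PoincareDisk) : ((u : Plane), height u) ∈ halfCone :=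
  ⟨height_ne u.norm_le, height_nonneg _⟩

/-- The self-map of the disk induced by a self-map of the half space. -/
noncomputable def diskMap (Ψ : Plane × ℝ → Plane × ℝ) (u : PoincareDisk) : PoincareDisk :=
  diskPoint (Ψ (u, height u)).1 (Ψ (u, height u)).2

lemma IsConeMap.diskMap_diskPoint {Ψ : Plane × ℝ → Plane × ℝ} (hΨ : IsConeMap Ψ)
    {x : Plane} {z : ℝ} (h : (x, z) ∈ halfCone) :
    diskMap Ψ (diskPoint x z) = diskPoint (Ψ (x, z)).1 (Ψ (x, z)).2 := by
  have hr : 0 < (√(‖x‖ ^ 2 + z ^ 2))⁻¹ := inv_pos.2 (Real.sqrt_pos.2 (compactify_den_pos h.1))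
  obtain ⟨s, hs, h2⟩ := hΨ.map_smul _ h _ hr
  have h1 : ((diskPoint x z : Plane), height (diskPoint x z)) =
      (√(‖x‖ ^ 2 + z ^ 2))⁻¹ • (x, z) := by
    rw [coe_diskPoint, height_compactify h.2 h.1]
    rfl
  rw [diskMap, h1, h2]
  exact diskPoint_smul hs _ _

lemma IsConeMap.continuous_diskMap {Ψ : Plane × ℝ → Plane × ℝ} (hΨ : IsConeMap Ψ) :
    Continuous (diskMap Ψ) := by
  refine Continuous.subtype_mk ?_ _
  have h1 : Continuous fun u : PoincareDisk => Ψ ((u : Plane), height u) :=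
    hΨ.continuousOn.comp_continuous
      (continuous_subtype_val.prodMk (continuous_height.comp continuous_subtype_val))
      mk_height_mem
  exact continuousOn_compactify.comp_continuous h1 fun u => (hΨ.mapsTo (mk_height_mem u)).1

/-- The disk is the quotient of the half space by positive scalars, so an inverse up to a positive
factor is enough. -/
lemma diskMap_leftInverse {Ψ Φ : Plane × ℝ → Plane × ℝ} (hΨ : IsConeMap Ψ) (hΦ : IsConeMap Φ)
    (h : ∀ p ∈ halfCone, ∃ s : ℝ, 0 < s ∧ Φ (Ψ p) = s • p) :
    Function.LeftInverse (diskMap Φ) (diskMap Ψ) := by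
  intro u
  obtain ⟨s, hs, h1⟩ := h _ (mk_height_mem u)
  change diskMap Φ (diskPoint _ _) = u
  rw [hΦ.diskMap_diskPoint (hΨ.mapsTo (mk_height_mem u)), h1]
  exact (diskPoint_smul hs _ _).trans (diskPoint_height u)

/-- Every disk solution lifts to some (η, z) with z constant, so it suffices to follow the lifted
solutions, up to a time change and a positive factor depending on t. -/
lemma orientedEquivalent_of_isConeMap {c d : Matrix (Fin 2) (Fin 2) ℝ}
    {Ψ Φ : Plane × ℝ → Plane × ℝ} (hΨ : IsConeMap Ψ) (hΦ : IsConeMap Φ)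
    (h : ∀ p ∈ halfCone, ∃ s : ℝ, 0 < s ∧ Φ (Ψ p) = s • p)
    (h' : ∀ p ∈ halfCone, ∃ s : ℝ, 0 < s ∧ Ψ (Φ p) = s • p)
    (hsol : ∀ (η : ℝ → Plane) (z : ℝ), IsSolution (linearField c) η →
      (∀ t, (η t, z) ∈ halfCone) → ∃ (ζ : ℝ → Plane) (w : ℝ) (σ : ℝ ≃o ℝ),
        IsSolution (linearField d) ζ ∧ ∀ t, ∃ s : ℝ, 0 < s ∧ Ψ (η t, z) = s • (ζ (σ t), w)) :
    OrientedEquivalent (linearField c) (linearField d) := by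
  refine ⟨⟨⟨diskMap Ψ, diskMap Φ, diskMap_leftInverse hΨ hΦ h, diskMap_leftInverse hΦ hΨ h'⟩,
    hΨ.continuous_diskMap, hΦ.continuous_diskMap⟩, fun u => ?_, fun γ hγ => ?_⟩
  · change ‖(u : Plane)‖ = 1 ↔ ‖compactify _ _‖ = 1
    rw [norm_compactify_eq_one_iff (hΨ.mapsTo (mk_height_mem u)).1,
      hΨ.snd_eq_zero_iff _ (mk_height_mem u), height_eq_zero_iff u.norm_le]
  · obtain ⟨η, hη, h0⟩ := exists_isSolution_linearField c (γ 0)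
    have hmem : ∀ t, (η t, height (γ 0)) ∈ halfCone := fun t =>
      ⟨(height_ne (γ 0).norm_le).imp_left fun hne => hη.ne_zero (h0 ▸ hne) t, height_nonneg _⟩
    obtain ⟨ζ, w, σ, hζ, hs⟩ := hsol η _ hη hmem
    have hne : ζ 0 ≠ 0 ∨ w ≠ 0 := by
      obtain ⟨s, -, h1⟩ := hs (σ.symm 0)
      rw [σ.apply_symm_apply] at h1
      have h2 := (hΨ.mapsTo (hmem (σ.symm 0))).1
      rw [h1] at h2
      exact h2.imp right_ne_zero_of_smul right_ne_zero_of_mul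
    refine ⟨fun t => diskPoint (ζ t) w, hζ.compactify hne, σ, fun t => ?_⟩
    obtain ⟨s, hs0, h1⟩ := hs t
    rw [hγ.eq_diskPoint hη h0 t]
    change diskMap Ψ _ = _
    rw [hΨ.diskMap_diskPoint (hmem t), h1]
    exact diskPoint_smul hs0 _ _

/-! ### Linear conjugacy -/

lemma linearField_ne_zero {S T : Matrix (Fin 2) (Fin 2) ℝ} (h : S * T = 1) {x : Plane}
    (hx : x ≠ 0) : linearField T x ≠ 0 := by
  intro h0
  apply hx
  rw [← linearField_one x, ← h, linearField_mul, h0, linearField_zero]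

lemma isConeMap_linear {S T : Matrix (Fin 2) (Fin 2) ℝ} (h : S * T = 1) :
    IsConeMap fun p => (linearField T p.1, p.2) where
  continuousOn :=
    (((continuous_linearField T).comp continuous_fst).prodMk continuous_snd).continuousOn
  mapsTo := fun p hp => ⟨hp.1.imp_left (linearField_ne_zero h), hp.2⟩
  snd_eq_zero_iff := fun _ _ => Iff.rfl
  map_smul := fun p _ r hr => ⟨r, hr, by simp [linearField_smul]⟩

lemma orientedEquivalent_of_conj {c d S T : Matrix (Fin 2) (Fin 2) ℝ} (hST : S * T = 1)
    (h : d * T = T * c) : OrientedEquivalent (linearField c) (linearField d) := by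
  have hTS : T * S = 1 := mul_eq_one_comm.1 hST
  refine orientedEquivalent_of_isConeMap (isConeMap_linear hST) (isConeMap_linear hTS)
    (fun p _ => ⟨1, one_pos, ?_⟩) (fun p _ => ⟨1, one_pos, ?_⟩) fun η z hη _ =>
    ⟨_, z, OrderIso.refl ℝ, hη.linear_comp h, fun t => ⟨1, one_pos, by simp⟩⟩
  · simp [← linearField_mul, hST]
  · simp [← linearField_mul, hTS]

/-! ### Signed powers -/

/-- The odd extension of `x ↦ x ^ e`. -/
noncomputable def signedPow (e x : ℝ) : ℝ := (max x 0) ^ e - (max (-x) 0) ^ e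

lemma signedPow_neg (e x : ℝ) : signedPow e (-x) = -signedPow e x := by
  simp [signedPow]

lemma signedPow_of_nonneg {e x : ℝ} (he : 0 < e) (hx : 0 ≤ x) : signedPow e x = x ^ e := by
  rw [signedPow, max_eq_left hx, max_eq_right (by linarith), Real.zero_rpow he.ne', sub_zero]

lemma continuous_signedPow {e : ℝ} (he : 0 < e) : Continuous (signedPow e) := by
  unfold signedPow
  exact ((continuous_id.max continuous_const).rpow_const fun _ => Or.inr he.le).sub
    ((continuous_neg.max continuous_const).rpow_const fun _ => Or.inr he.le)

lemma signedPow_mul {e r : ℝ} (he : 0 < e) (hr : 0 ≤ r) (x : ℝ) :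
    signedPow e (r * x) = r ^ e * signedPow e x := by
  have key : ∀ y : ℝ, 0 ≤ y → signedPow e (r * y) = r ^ e * signedPow e y := fun y hy => by
    rw [signedPow_of_nonneg he (mul_nonneg hr hy), signedPow_of_nonneg he hy,
      Real.mul_rpow hr hy]
  rcases le_total 0 x with hx | hx
  · exact key x hx
  · have := key (-x) (by linarith)
    rwa [mul_neg, signedPow_neg, signedPow_neg, mul_neg, neg_inj] at this

lemma abs_signedPow {e : ℝ} (he : 0 < e) (x : ℝ) : |signedPow e x| = |x| ^ e := by
  rcases le_total 0 x with hx | hx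
  · rw [signedPow_of_nonneg he hx, abs_of_nonneg hx, abs_of_nonneg (Real.rpow_nonneg hx e)]
  · rw [← neg_neg x, signedPow_neg, abs_neg, abs_neg, signedPow_of_nonneg he (by linarith),
      abs_of_nonneg (by linarith : 0 ≤ -x), abs_of_nonneg (Real.rpow_nonneg (by linarith) e)]

lemma signedPow_eq_zero_iff {e : ℝ} (he : 0 < e) {x : ℝ} : signedPow e x = 0 ↔ x = 0 := by
  rw [← abs_eq_zero, abs_signedPow he, Real.rpow_eq_zero (abs_nonneg x) he.ne', abs_eq_zero]

lemma signedPow_signedPow {e e' : ℝ} (he : 0 < e) (he' : 0 < e') (h : e * e' = 1) (x : ℝ) :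
    signedPow e' (signedPow e x) = x := by
  have key : ∀ y : ℝ, 0 ≤ y → signedPow e' (signedPow e y) = y := fun y hy => by
    rw [signedPow_of_nonneg he hy, signedPow_of_nonneg he' (Real.rpow_nonneg hy e),
      ← Real.rpow_mul hy, h, Real.rpow_one]
  rcases le_total 0 x with hx | hx
  · exact key x hx
  · have := key (-x) (by linarith)
    rwa [signedPow_neg, signedPow_neg, neg_inj] at this

/-! ### Diagonal fields -/

/-- The sup norm on the space of homogeneous coordinates. -/
noncomputable def supNorm (p : Plane × ℝ) : ℝ := max (max |p.1 0| |p.1 1|) |p.2|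

lemma continuous_supNorm : Continuous supNorm := by
  unfold supNorm
  fun_prop

lemma supNorm_pos {p : Plane × ℝ} (hp : p ∈ halfCone) : 0 < supNorm p := by
  rcases hp.1 with h | h
  · by_contra! h0
    apply h
    have h1 : |p.1 0| ≤ 0 := ((le_max_left _ _).trans (le_max_left _ _)).trans h0
    have h2 : |p.1 1| ≤ 0 := ((le_max_right _ _).trans (le_max_left _ _)).trans h0
    exact plane_ext (abs_nonpos_iff.1 h1) (abs_nonpos_iff.1 h2)
  · exact lt_max_of_lt_right (abs_pos.2 h)

lemma supNorm_smul {r : ℝ} (hr : 0 < r) (p : Plane × ℝ) : supNorm (r • p) = r * supNorm p := by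
  simp [supNorm, abs_mul, abs_of_pos hr, mul_max_of_nonneg _ _ hr.le]

/-- Coordinatewise signed powers. -/
noncomputable def coordPow (e : Fin 3 → ℝ) (p : Plane × ℝ) : Plane × ℝ :=
  (!₂[signedPow (e 0) (p.1 0), signedPow (e 1) (p.1 1)], signedPow (e 2) p.2)

/-- Coordinatewise signed powers on vectors normalised by the sup norm. -/
noncomputable def conePow (e : Fin 3 → ℝ) (p : Plane × ℝ) : Plane × ℝ :=
  coordPow e ((supNorm p)⁻¹ • p)

lemma supNorm_normalize {p : Plane × ℝ} (hp : p ∈ halfCone) :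
    supNorm ((supNorm p)⁻¹ • p) = 1 := by
  rw [supNorm_smul (inv_pos.2 (supNorm_pos hp)), inv_mul_cancel₀ (supNorm_pos hp).ne']

/-- A coordinate of absolute value 1 keeps it under any power, and the others stay at most 1. This
is why the sup norm is used: its unit sphere is stable under unequal exponents. -/
lemma supNorm_coordPow {e : Fin 3 → ℝ} (he : ∀ i, 0 < e i) {p : Plane × ℝ}
    (hp : supNorm p = 1) : supNorm (coordPow e p) = 1 := by
  have h0 : |p.1 0| ≤ 1 := hp ▸ (le_max_left _ _).trans (le_max_left _ _)
  have h1 : |p.1 1| ≤ 1 := hp ▸ (le_max_right _ _).trans (le_max_left _ _)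
  have h2 : |p.2| ≤ 1 := hp ▸ le_max_right _ _
  have k0 := Real.rpow_le_one (abs_nonneg _) h0 (he 0).le
  have k1 := Real.rpow_le_one (abs_nonneg _) h1 (he 1).le
  have k2 := Real.rpow_le_one (abs_nonneg _) h2 (he 2).le
  have hs : supNorm (coordPow e p) =
      max (max (|p.1 0| ^ e 0) (|p.1 1| ^ e 1)) (|p.2| ^ e 2) := by
    simp [supNorm, coordPow, abs_signedPow (he _)]
  rw [hs]
  refine le_antisymm (max_le (max_le k0 k1) k2) ?_
  rw [supNorm] at hp
  rcases max_choice (max |p.1 0| |p.1 1|) |p.2| with h | h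
  · rcases max_choice |p.1 0| |p.1 1| with h' | h'
    · rw [h, h'] at hp
      simp [hp]
    · rw [h, h'] at hp
      simp [hp]
  · rw [h] at hp
    simp [hp]

lemma coordPow_coordPow {e e' : Fin 3 → ℝ} (he : ∀ i, 0 < e i) (he' : ∀ i, 0 < e' i)
    (h : ∀ i, e i * e' i = 1) (p : Plane × ℝ) : coordPow e' (coordPow e p) = p := by
  refine Prod.ext (plane_ext ?_ ?_) ?_
  · simp [coordPow, signedPow_signedPow (he _) (he' _) (h _)]
  · simp [coordPow, signedPow_signedPow (he _) (he' _) (h _)]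
  · simp [coordPow, signedPow_signedPow (he _) (he' _) (h _)]

/-- The first map lands on the unit sup-norm sphere, so the second normalisation does nothing and
the powers cancel; only the initial scaling remains. -/
lemma conePow_conePow {e e' : Fin 3 → ℝ} (he : ∀ i, 0 < e i) (he' : ∀ i, 0 < e' i)
    (h : ∀ i, e i * e' i = 1) {p : Plane × ℝ} (hp : p ∈ halfCone) :
    conePow e' (conePow e p) = (supNorm p)⁻¹ • p := by
  have h1 : supNorm (conePow e p) = 1 := supNorm_coordPow he (supNorm_normalize hp)
  rw [conePow, h1, inv_one, one_smul, conePow, coordPow_coordPow he he' h]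

lemma continuous_coordPow {e : Fin 3 → ℝ} (he : ∀ i, 0 < e i) : Continuous (coordPow e) := by
  have h0 := continuous_signedPow (he 0)
  have h1 := continuous_signedPow (he 1)
  have h2 := continuous_signedPow (he 2)
  unfold coordPow
  refine Continuous.prodMk ?_ (h2.comp continuous_snd)
  refine (PiLp.continuous_toLp 2 _).comp (continuous_pi fun i => ?_)
  fin_cases i
  · exact h0.comp (by fun_prop)
  · exact h1.comp (by fun_prop)

lemma isConeMap_conePow {e : Fin 3 → ℝ} (he : ∀ i, 0 < e i) : IsConeMap (conePow e) where
  continuousOn :=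
    (continuous_coordPow he).comp_continuousOn
      ((continuous_supNorm.continuousOn.inv₀ fun _ hp => (supNorm_pos hp).ne').smul
        continuousOn_id)
  mapsTo := by
    intro p hp
    have hq := smul_mem_halfCone hp (inv_pos.2 (supNorm_pos hp))
    refine ⟨?_, ?_⟩
    · by_contra! h
      have h1 : supNorm (conePow e p) = 1 := supNorm_coordPow he (supNorm_normalize hp)
      rw [supNorm, h.1, h.2] at h1
      simp at h1
    · change 0 ≤ signedPow _ _
      rw [signedPow_of_nonneg (he 2) hq.2]
      exact Real.rpow_nonneg hq.2 _
  snd_eq_zero_iff := by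
    intro p hp
    change signedPow _ ((supNorm p)⁻¹ * p.2) = 0 ↔ _
    rw [signedPow_eq_zero_iff (he 2)]
    simp [(supNorm_pos hp).ne']
  map_smul := by
    intro p hp r hr
    refine ⟨1, one_pos, ?_⟩
    rw [one_smul, conePow, supNorm_smul hr, smul_smul, mul_inv, mul_right_comm,
      inv_mul_cancel₀ hr.ne', one_mul, conePow]

/-- Linear growth makes `f` strictly increasing and unbounded in both directions. No derivative is
involved, which matters because the logarithm of a sup norm is only piecewise smooth. -/
lemma exists_orderIso_of_lower_bound {f : ℝ → ℝ} (hf : Continuous f) {k : ℝ} (hk : 0 < k)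
    (h : ∀ s t, s ≤ t → k * (t - s) ≤ f t - f s) : ∃ σ : ℝ ≃o ℝ, ∀ t, σ t = f t := by
  have hmono : StrictMono f := fun s t hst => by
    have h1 := h s t hst.le
    have h2 := mul_pos hk (sub_pos.2 hst)
    linarith
  have htop : Tendsto f atTop atTop := by
    refine tendsto_atTop_mono' atTop (f₁ := fun t => k * t + f 0) ?_
      (tendsto_atTop_add_const_right _ _ (tendsto_id.const_mul_atTop hk))
    filter_upwards [eventually_ge_atTop 0] with t ht
    have := h 0 t ht
    linarith
  have hbot : Tendsto f atBot atBot := by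
    refine tendsto_atBot_mono' atBot (f₁ := fun t => k * t + f 0) ?_
      (tendsto_atBot_add_const_right _ _ (tendsto_id.const_mul_atBot hk))
    filter_upwards [eventually_le_atBot 0] with t ht
    have := h t 0 ht
    linarith
  exact ⟨hmono.orderIsoOfSurjective f (hf.surjective htop hbot), fun _ => rfl⟩

/-- The solution of the diagonal system. -/
noncomputable def diagSolution (a b : ℝ) (x : Plane) (t : ℝ) : Plane :=
  !₂[Real.exp (a * t) * x 0, Real.exp (b * t) * x 1]

lemma isSolution_diagSolution (a b : ℝ) (x : Plane) :
    IsSolution (linearField !![a, 0; 0, b]) (diagSolution a b x) := by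
  intro t
  have key : ∀ r y : ℝ, HasDerivAt (fun s => Real.exp (r * s) * y)
      (r * (Real.exp (r * t) * y)) t := fun r y => by
    have h1 : HasDerivAt (fun s : ℝ => r * s) r t := by simpa using (hasDerivAt_id t).const_mul r
    exact (h1.exp.mul_const y).congr_deriv (by ring)
  refine hasDerivAt_plane ?_ ?_
  · simpa [diagSolution, linearField] using key a (x 0)
  · simpa [diagSolution, linearField] using key b (x 1)

lemma diagSolution_zero (a b : ℝ) (x : Plane) : diagSolution a b x 0 = x :=
  plane_ext (by simp [diagSolution]) (by simp [diagSolution])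

lemma supNorm_diagSolution_le {a b : ℝ} (x : Plane) (z : ℝ) {s t r : ℝ}
    (ha : a * (t - s) ≤ r) (hb : b * (t - s) ≤ r) (h0 : 0 ≤ r) :
    supNorm (diagSolution a b x t, z) ≤ Real.exp r * supNorm (diagSolution a b x s, z) := by
  have key : ∀ k y : ℝ, k * (t - s) ≤ r →
      |Real.exp (k * t) * y| ≤ Real.exp r * |Real.exp (k * s) * y| := fun k y hk => by
    rw [abs_mul, abs_mul, Real.abs_exp, Real.abs_exp, ← mul_assoc, ← Real.exp_add]
    gcongr
    linarith
  have k0 := key a (x 0) ha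
  have k1 := key b (x 1) hb
  have k2 : |z| ≤ Real.exp r * |z| :=
    le_mul_of_one_le_left (abs_nonneg z) (Real.one_le_exp h0)
  simp only [supNorm, diagSolution]
  rw [mul_max_of_nonneg _ _ (Real.exp_pos r).le, mul_max_of_nonneg _ _ (Real.exp_pos r).le]
  exact max_le_max (max_le_max k0 k1) k2

/-- The three coordinates grow at rates a, b and 0, so the logarithm of their maximum has slope
between the extreme rates. The sign of t - s is left free so that upper and lower bounds are both
instances. -/
lemma log_supNorm_diagSolution_le {a b m : ℝ} {x : Plane} {z : ℝ}
    (hmem : ∀ t, (diagSolution a b x t, z) ∈ halfCone) {s t : ℝ}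
    (ha : a * (t - s) ≤ m * (t - s)) (hb : b * (t - s) ≤ m * (t - s)) (h0 : 0 ≤ m * (t - s)) :
    Real.log (supNorm (diagSolution a b x t, z)) - Real.log (supNorm (diagSolution a b x s, z))
      ≤ m * (t - s) := by
  have h := Real.log_le_log (supNorm_pos (hmem t)) (supNorm_diagSolution_le x z ha hb h0)
  rw [Real.log_mul (Real.exp_ne_zero _) (supNorm_pos (hmem s)).ne', Real.log_exp] at h
  linarith

/-- The time change along an orbit of a diagonal field induced by `conePow`. -/
lemma exists_time_change {a b A B : ℝ} (hA : 0 < A) (hAa : 0 < A - B * a) (hAb : 0 < A - B * b)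
    {x : Plane} {z : ℝ} (hmem : ∀ t, (diagSolution a b x t, z) ∈ halfCone) :
    ∃ σ : ℝ ≃o ℝ, ∀ t, σ t = A * t - B * Real.log (supNorm (diagSolution a b x t, z)) := by
  have hcont : Continuous fun t => A * t -
      B * Real.log (supNorm (diagSolution a b x t, z)) := by
    have h1 : Continuous (diagSolution a b x) :=
      continuous_iff_continuousAt.2 fun t => (isSolution_diagSolution a b x t).continuousAt
    have h2 : Continuous fun t => supNorm (diagSolution a b x t, z) :=
      continuous_supNorm.comp (h1.prodMk continuous_const)
    exact (continuous_const.mul continuous_id).sub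
      (continuous_const.mul (h2.log fun t => (supNorm_pos (hmem t)).ne'))
  have hlow : ∃ k : ℝ, 0 < k ∧ ∀ s t, s ≤ t → k * (t - s) ≤
      (A * t - B * Real.log (supNorm (diagSolution a b x t, z))) -
      (A * s - B * Real.log (supNorm (diagSolution a b x s, z))) := by
    -- The slope of σ is least where the logarithm grows fastest if B ≥ 0, and slowest if B ≤ 0. The
    -- extreme rate is one of a, b, 0, and A - B·rate is positive at all three.
    rcases le_total 0 B with hB | hB
    · refine ⟨A - B * max (max a b) 0, ?_, fun s t hst => ?_⟩
      · rw [mul_max_of_nonneg _ _ hB, mul_max_of_nonneg _ _ hB, sub_pos]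
        exact max_lt (max_lt (by linarith) (by linarith)) (by simpa using hA)
      · have hd := sub_nonneg.2 hst
        have := log_supNorm_diagSolution_le hmem (m := max (max a b) 0)
          (mul_le_mul_of_nonneg_right ((le_max_left a b).trans (le_max_left _ _)) hd)
          (mul_le_mul_of_nonneg_right ((le_max_right a b).trans (le_max_left _ _)) hd)
          (mul_nonneg (le_max_right _ _) hd)
        have := mul_le_mul_of_nonneg_left this hB
        nlinarith
    · refine ⟨A - B * min (min a b) 0, ?_, fun s t hst => ?_⟩
      · rcases min_choice (min a b) 0 with h | h
        · rcases min_choice a b with h' | h' <;> rw [h, h'] <;> assumption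
        · rw [h]
          simpa using hA
      · have hd := sub_nonneg.2 hst
        have hd' : s - t ≤ 0 := by linarith
        have := log_supNorm_diagSolution_le hmem (s := t) (t := s) (m := min (min a b) 0)
          (mul_le_mul_of_nonpos_right ((min_le_left _ _).trans (min_le_left a b)) hd')
          (mul_le_mul_of_nonpos_right ((min_le_left _ _).trans (min_le_right a b)) hd')
          (mul_nonneg_of_nonpos_of_nonpos (min_le_right _ _) hd')
        have := mul_le_mul_of_nonneg_left this (neg_nonneg.2 hB)
        nlinarith
  obtain ⟨k, hk, h⟩ := hlow
  exact exists_orderIso_of_lower_bound hcont hk h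

lemma signedPow_exp_div {e r m : ℝ} (he : 0 < e) (hm : 0 < m) (y : ℝ) :
    signedPow e (m⁻¹ * (Real.exp r * y)) = Real.exp (e * (r - Real.log m)) * signedPow e y := by
  have h : m⁻¹ * (Real.exp r * y) = Real.exp (r - Real.log m) * y := by
    rw [Real.exp_sub, Real.exp_log hm]
    ring
  rw [h, signedPow_mul he (Real.exp_pos _).le, ← Real.exp_mul, mul_comm e]

/-- Diagonal fields whose rates are related by a Möbius transformation that is monotone on the
relevant points are equivalent. -/
lemma orientedEquivalent_diag {a b a' b' A B : ℝ} {e : Fin 3 → ℝ} (he : ∀ i, 0 < e i)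
    (hA : 0 < A) (hAa : 0 < A - B * a) (hAb : 0 < A - B * b)
    (h0 : e 0 * a = A * a') (h1 : e 1 * b = A * b')
    (h0' : e 0 = B * a' + e 2) (h1' : e 1 = B * b' + e 2) :
    OrientedEquivalent (linearField !![a, 0; 0, b]) (linearField !![a', 0; 0, b']) := by
  have he' : ∀ i, 0 < (e i)⁻¹ := fun i => inv_pos.2 (he i)
  have hmul : ∀ i, e i * (e i)⁻¹ = 1 := fun i => mul_inv_cancel₀ (he i).ne'
  refine orientedEquivalent_of_isConeMap (isConeMap_conePow he) (isConeMap_conePow he')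
    (fun p hp => ⟨_, inv_pos.2 (supNorm_pos hp), conePow_conePow he he' hmul hp⟩)
    (fun p hp => ⟨_, inv_pos.2 (supNorm_pos hp),
      conePow_conePow he' he (fun i => inv_mul_cancel₀ (he i).ne') hp⟩) ?_
  intro η z hη hmem
  obtain ⟨x, rfl⟩ : ∃ x, η = diagSolution a b x := ⟨η 0,
    hη.eq_of_eq (isSolution_diagSolution a b _) (t₀ := 0) (diagSolution_zero a b _).symm⟩
  obtain ⟨σ, hσ⟩ := exists_time_change hA hAa hAb hmem
  refine ⟨diagSolution a' b' !₂[signedPow (e 0) (x 0), signedPow (e 1) (x 1)],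
    signedPow (e 2) z, σ, isSolution_diagSolution _ _ _, fun t => ?_⟩
  have hm := supNorm_pos (hmem t)
  set m := supNorm (diagSolution a b x t, z) with hmdef
  -- The factor is forced by the third coordinate, whose rate is 0. Comparing exponents in the other
  -- two gives e₀(at - log m) = a'σ - e₂ log m and its analogue for b; with σ = At - B log m these
  -- are the four relations assumed.
  refine ⟨Real.exp (-(e 2 * Real.log m)), Real.exp_pos _, ?_⟩
  have k0 := signedPow_exp_div (he 0) hm (x 0) (r := a * t)
  have k1 := signedPow_exp_div (he 1) hm (x 1) (r := b * t)
  have k2 := signedPow_exp_div (he 2) hm z (r := 0)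
  refine Prod.ext (plane_ext ?_ ?_) ?_
  · change signedPow (e 0) (m⁻¹ * (Real.exp (a * t) * x 0)) =
      Real.exp (-(e 2 * Real.log m)) * (Real.exp (a' * σ t) * signedPow (e 0) (x 0))
    rw [k0, ← mul_assoc, ← Real.exp_add, hσ]
    congr 2
    linear_combination t * h0 - Real.log m * h0'
  · change signedPow (e 1) (m⁻¹ * (Real.exp (b * t) * x 1)) =
      Real.exp (-(e 2 * Real.log m)) * (Real.exp (b' * σ t) * signedPow (e 1) (x 1))
    rw [k1, ← mul_assoc, ← Real.exp_add, hσ]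
    congr 2
    linear_combination t * h1 - Real.log m * h1'
  · change signedPow (e 2) (m⁻¹ * z) = Real.exp (-(e 2 * Real.log m)) * signedPow (e 2) z
    rw [Real.exp_zero, one_mul] at k2
    rw [k2]
    congr 2
    ring

lemma orientedEquivalent_saddle {a b : ℝ} (ha : 0 < a) (hb : b < 0) :
    OrientedEquivalent (linearField !![a, 0; 0, b])
      (linearField LinearPortrait.saddle.model) := by
  have hb' : 0 < -b := by linarith
  have h1 := mul_inv_cancel₀ ha.ne'
  have h2 := mul_inv_cancel₀ hb'.ne'
  have i1 := inv_pos.2 ha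
  have i2 := inv_pos.2 hb'
  -- With A = 1 and target rates 1, -1, the rate relations give e₀ = 1/a and e₁ = -1/b; then e₀ = B
  -- + e₂ and e₁ = -B + e₂ determine B and e₂.
  refine orientedEquivalent_diag (A := 1) (B := (a⁻¹ - (-b)⁻¹) / 2)
    (e := ![a⁻¹, (-b)⁻¹, (a⁻¹ + (-b)⁻¹) / 2]) ?_ one_pos ?_ ?_ ?_ ?_ ?_ ?_
  · intro i
    fin_cases i <;> simp only [Fin.zero_eta, Fin.mk_one, Fin.reduceFinMk, Matrix.cons_val] <;>
      positivity
  · nlinarith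
  · nlinarith
  · simp only [Matrix.cons_val]
    linarith
  · simp only [Matrix.cons_val]
    linarith
  · simp only [Matrix.cons_val]
    ring
  · simp only [Matrix.cons_val]
    ring

lemma orientedEquivalent_node {a b : ℝ} (ha : a < 0) (hab : b < a) :
    OrientedEquivalent (linearField !![a, 0; 0, b])
      (linearField LinearPortrait.node.model) := by
  obtain ⟨p, rfl⟩ : ∃ p, a = -p := ⟨-a, by ring⟩
  obtain ⟨q, rfl⟩ : ∃ q, b = -q := ⟨-b, by ring⟩
  have hp : 0 < p := by linarith
  have hpq : p < q := by linarith
  have hq : 0 < q := by linarith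
  have h1 := mul_inv_cancel₀ hp.ne'
  have h2 := mul_inv_cancel₀ hq.ne'
  have i1 := inv_pos.2 hp
  have i2 := inv_pos.2 hq
  have h3 : q⁻¹ < p⁻¹ := inv_strictAnti₀ hp hpq
  -- Target rates -1, -2 give e₀ = 1/p and e₁ = 2/q; then e₀ = -B + e₂ and e₁ = -2B + e₂ determine
  -- the rest. Positivity of e₂ is exactly p < q.
  refine orientedEquivalent_diag (A := 1) (B := p⁻¹ - 2 * q⁻¹)
    (e := ![p⁻¹, 2 * q⁻¹, 2 * p⁻¹ - 2 * q⁻¹]) ?_ one_pos ?_ ?_ ?_ ?_ ?_ ?_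
  · intro i
    fin_cases i <;> simp only [Fin.zero_eta, Fin.mk_one, Fin.reduceFinMk, Matrix.cons_val] <;>
      linarith
  · nlinarith
  · nlinarith
  · simp only [Matrix.cons_val]
    linarith
  · simp only [Matrix.cons_val]
    linarith
  · simp only [Matrix.cons_val]
    ring
  · simp only [Matrix.cons_val]
    ring

/-! ### Focal fields -/

/-- The radial homeomorphism `x ↦ ‖x‖ ^ (e - 1) • x` of the plane. -/
noncomputable def radialPow (e : ℝ) (x : Plane) : Plane := ‖x‖ ^ (e - 1) • x

lemma norm_radialPow {e : ℝ} (he : 0 < e) (x : Plane) : ‖radialPow e x‖ = ‖x‖ ^ e := by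
  rcases eq_or_ne x 0 with rfl | hx
  · simp [radialPow, Real.zero_rpow he.ne']
  · have h := norm_pos_iff.2 hx
    rw [radialPow, norm_smul, Real.norm_of_nonneg (Real.rpow_nonneg h.le _),
      Real.rpow_sub_one h.ne', div_mul_cancel₀ _ h.ne']

lemma radialPow_ne_zero {e : ℝ} (he : 0 < e) {x : Plane} (hx : x ≠ 0) : radialPow e x ≠ 0 := by
  rw [← norm_pos_iff, norm_radialPow he]
  exact Real.rpow_pos_of_pos (norm_pos_iff.2 hx) e

lemma radialPow_smul {e r : ℝ} (hr : 0 < r) (x : Plane) :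
    radialPow e (r • x) = r ^ e • radialPow e x := by
  rw [radialPow, radialPow, norm_smul, Real.norm_of_nonneg hr.le,
    Real.mul_rpow hr.le (norm_nonneg x), smul_smul, smul_smul, Real.rpow_sub_one hr.ne']
  congr 1
  field_simp

lemma radialPow_radialPow {e e' : ℝ} (he : 0 < e) (h : e * e' = 1) (x : Plane) :
    radialPow e' (radialPow e x) = x := by
  rcases eq_or_ne x 0 with rfl | hx
  · simp [radialPow]
  · have hn := norm_pos_iff.2 hx
    rw [radialPow, norm_radialPow he, radialPow, smul_smul, ← Real.rpow_mul hn.le,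
      ← Real.rpow_add hn, show e * (e' - 1) + (e - 1) = 0 by linarith, Real.rpow_zero, one_smul]

lemma continuous_radialPow {e : ℝ} (he : 0 < e) : Continuous (radialPow e) := by
  refine continuous_iff_continuousAt.2 fun x => ?_
  rcases eq_or_ne x 0 with rfl | hx
  · have h0 : radialPow e 0 = 0 := by simp [radialPow]
    rw [ContinuousAt, h0, tendsto_zero_iff_norm_tendsto_zero]
    simp_rw [norm_radialPow he]
    have h1 : Continuous fun x : Plane => ‖x‖ ^ e :=
      continuous_norm.rpow_const fun _ => Or.inr he.le
    simpa [Real.zero_rpow he.ne'] using h1.tendsto 0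
  · exact (continuous_norm.continuousAt.rpow_const (Or.inl (norm_ne_zero_iff.2 hx))).smul
      continuousAt_id

/-- The map of the half space that is radial in both factors. -/
noncomputable def coneRadial (e : ℝ) (p : Plane × ℝ) : Plane × ℝ := (radialPow e p.1, p.2 ^ e)

lemma isConeMap_coneRadial {e : ℝ} (he : 0 < e) : IsConeMap (coneRadial e) where
  continuousOn := (((continuous_radialPow he).comp continuous_fst).prodMk
    (continuous_snd.rpow_const fun _ => Or.inr he.le)).continuousOn
  mapsTo := fun _ hp => ⟨hp.1.imp (radialPow_ne_zero he)
    fun h => (Real.rpow_pos_of_pos (hp.2.lt_of_ne' h) e).ne', Real.rpow_nonneg hp.2 e⟩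
  snd_eq_zero_iff := fun _ hp => Real.rpow_eq_zero hp.2 he.ne'
  map_smul := fun _ hp r hr => ⟨r ^ e, Real.rpow_pos_of_pos hr e,
    Prod.ext (radialPow_smul hr _) (Real.mul_rpow hr.le hp.2)⟩

lemma coneRadial_coneRadial {e e' : ℝ} (he : 0 < e) (h : e * e' = 1) {p : Plane × ℝ}
    (hp : p ∈ halfCone) : coneRadial e' (coneRadial e p) = p := by
  refine Prod.ext (radialPow_radialPow he h _) ?_
  change (p.2 ^ e) ^ e' = p.2
  rw [← Real.rpow_mul hp.2, h, Real.rpow_one]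

/-- The solution of the system with matrix `!![a, -b; b, a]`. -/
noncomputable def spiral (a b : ℝ) (x : Plane) (t : ℝ) : Plane :=
  Real.exp (a * t) • !₂[Real.cos (b * t) * x 0 - Real.sin (b * t) * x 1,
    Real.sin (b * t) * x 0 + Real.cos (b * t) * x 1]

lemma isSolution_spiral (a b : ℝ) (x : Plane) :
    IsSolution (linearField !![a, -b; b, a]) (spiral a b x) := by
  intro t
  have hl : ∀ r : ℝ, HasDerivAt (fun s : ℝ => r * s) r t := fun r => by
    simpa using (hasDerivAt_id t).const_mul r
  have h1 := (hl a).exp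
  have h2 := (hl b).cos
  have h3 := (hl b).sin
  refine hasDerivAt_plane ?_ ?_
  · have := h1.mul ((h2.mul_const (x 0)).sub (h3.mul_const (x 1)))
    simp only [spiral, linearField]
    refine this.congr_deriv ?_
    simp
    ring
  · have := h1.mul ((h3.mul_const (x 0)).add (h2.mul_const (x 1)))
    simp only [spiral, linearField]
    refine this.congr_deriv ?_
    simp
    ring

lemma spiral_zero (a b : ℝ) (x : Plane) : spiral a b x 0 = x :=
  plane_ext (by simp [spiral]) (by simp [spiral])

lemma spiral_smul (a b r : ℝ) (x : Plane) (t : ℝ) : spiral a b (r • x) t = r • spiral a b x t := by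
  refine plane_ext ?_ ?_ <;> simp [spiral] <;> ring

lemma norm_spiral (a b : ℝ) (x : Plane) (t : ℝ) : ‖spiral a b x t‖ = Real.exp (a * t) * ‖x‖ := by
  have h := Real.sin_sq_add_cos_sq (b * t)
  rw [spiral, norm_smul, Real.norm_of_nonneg (Real.exp_pos _).le]
  congr 1
  rw [← sq_eq_sq₀ (norm_nonneg _) (norm_nonneg _), norm_sq_plane, norm_sq_plane]
  simp only [Matrix.cons_val]
  linear_combination (x 0 ^ 2 + x 1 ^ 2) * h

/-- The power acts on the radius, which evolves by exp(at), and leaves the angle alone: the radial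
rate is multiplied by e and the rotation rate is unchanged. -/
lemma radialPow_spiral {a b e : ℝ} (x : Plane) (t : ℝ) :
    radialPow e (spiral a b x t) = spiral (e * a) b (radialPow e x) t := by
  rw [radialPow, norm_spiral, radialPow, spiral_smul, spiral, spiral, smul_smul, smul_smul,
    Real.mul_rpow (Real.exp_pos _).le (norm_nonneg x), ← Real.exp_mul]
  congr 1
  rw [mul_right_comm, ← Real.exp_add, mul_comm]
  congr 2
  ring

lemma orientedEquivalent_focus {a b : ℝ} (ha : a < 0) (hb : 0 < b) :
    OrientedEquivalent (linearField !![a, -b; b, a])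
      (linearField LinearPortrait.focus.model) := by
  have he : 0 < b / -a := div_pos hb (by linarith)
  have he' : 0 < -a / b := div_pos (by linarith) hb
  have h1 : b / -a * (-a / b) = 1 := div_mul_div_cancel₀ (by linarith) |>.trans (div_self hb.ne')
  have h2 : -a / b * (b / -a) = 1 := by rw [mul_comm, h1]
  have h3 : b / -a * a = -b := by
    have := ha.ne
    field_simp
  refine orientedEquivalent_of_isConeMap (isConeMap_coneRadial he) (isConeMap_coneRadial he')
    (fun p hp => ⟨1, one_pos, by rw [one_smul, coneRadial_coneRadial he h1 hp]⟩)
    (fun p hp => ⟨1, one_pos, by rw [one_smul, coneRadial_coneRadial he' h2 hp]⟩) ?_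
  intro η z hη hmem
  obtain ⟨x, rfl⟩ : ∃ x, η = spiral a b x := ⟨η 0,
    hη.eq_of_eq (isSolution_spiral a b _) (t₀ := 0) (spiral_zero a b _).symm⟩
  -- The exponent b/(-a) turns the rates (a, b) into (-b, b), which is the model run at speed b.
  refine ⟨spiral (-1) 1 (radialPow (b / -a) x), z ^ (b / -a), OrderIso.mulLeft₀ b hb,
    isSolution_spiral _ _ _, fun t => ⟨1, one_pos, ?_⟩⟩
  rw [one_smul, coneRadial, radialPow_spiral, h3]
  simp [spiral]

/-! ### Canonical forms -/

/-- The discriminant of the characteristic polynomial. -/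
def charDisc (c : Matrix (Fin 2) (Fin 2) ℝ) : ℝ := (c 0 0 - c 1 1) ^ 2 + 4 * (c 0 1 * c 1 0)

lemma charDisc_eq (c : Matrix (Fin 2) (Fin 2) ℝ) : charDisc c = c.trace ^ 2 - 4 * c.det := by
  rw [charDisc, Matrix.trace_fin_two, Matrix.det_fin_two]
  ring

lemma charDisc_neg (c : Matrix (Fin 2) (Fin 2) ℝ) : charDisc (-c) = charDisc c := by
  simp [charDisc]
  ring

lemma det_neg_two (c : Matrix (Fin 2) (Fin 2) ℝ) : (-c).det = c.det := by
  simp [Matrix.det_fin_two]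

lemma exists_conj_diag {c : Matrix (Fin 2) (Fin 2) ℝ} {a b : ℝ} (hab : a ≠ b)
    (htr : a + b = c.trace) (hdet : a * b = c.det) :
    ∃ S T : Matrix (Fin 2) (Fin 2) ℝ, S * T = 1 ∧ c * T = T * !![a, 0; 0, b] := by
  suffices h : ∃ T : Matrix (Fin 2) (Fin 2) ℝ, T.det ≠ 0 ∧ c * T = T * !![a, 0; 0, b] by
    obtain ⟨T, hT, h⟩ := h
    exact ⟨T⁻¹, T, Matrix.nonsing_inv_mul _ (isUnit_iff_ne_zero.2 hT), h⟩
  rw [Matrix.trace_fin_two] at htr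
  rw [Matrix.det_fin_two] at hdet
  have ha : a ^ 2 - (c 0 0 + c 1 1) * a + (c 0 0 * c 1 1 - c 0 1 * c 1 0) = 0 := by
    rw [← htr, ← hdet]
    ring
  have hb : b ^ 2 - (c 0 0 + c 1 1) * b + (c 0 0 * c 1 1 - c 0 1 * c 1 0) = 0 := by
    rw [← htr, ← hdet]
    ring
  -- The columns of T are to be eigenvectors. Either row of c - a supplies one, provided its
  -- off-diagonal entry is nonzero; if both vanish, c is already diagonal up to order.
  by_cases hr : c 1 0 = 0
  · by_cases hq : c 0 1 = 0
    · have h : (a - c 0 0) * (a - c 1 1) = 0 := by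
        rw [hr] at ha
        linear_combination ha
      rcases mul_eq_zero.1 h with h | h
      · refine ⟨1, by simp, ?_⟩
        have h0 : a = c 0 0 := by linarith
        have h1 : b = c 1 1 := by linarith
        ext i j
        fin_cases i <;> fin_cases j <;> simp [h0, h1, hr, hq]
      · refine ⟨!![0, 1; 1, 0], by simp [Matrix.det_fin_two], ?_⟩
        have h0 : a = c 1 1 := by linarith
        have h1 : b = c 0 0 := by linarith
        ext i j
        fin_cases i <;> fin_cases j <;> simp [Matrix.mul_apply, h0, h1, hr, hq]
    · refine ⟨!![c 0 1, c 0 1; a - c 0 0, b - c 0 0], ?_, ?_⟩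
      · rw [Matrix.det_fin_two_of]
        have := mul_ne_zero hq (sub_ne_zero.2 hab)
        intro h
        apply this
        linear_combination -h
      · ext i j
        fin_cases i <;> fin_cases j <;> simp [Matrix.mul_apply]
        · ring
        · ring
        · linear_combination -ha
        · linear_combination -hb
  · refine ⟨!![a - c 1 1, b - c 1 1; c 1 0, c 1 0], ?_, ?_⟩
    · rw [Matrix.det_fin_two_of]
      have := mul_ne_zero hr (sub_ne_zero.2 hab)
      intro h
      apply this
      linear_combination h
    · ext i j
      fin_cases i <;> fin_cases j <;> simp [Matrix.mul_apply]
      · linear_combination -ha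
      · linear_combination -hb
      · ring
      · ring

lemma exists_roots {c : Matrix (Fin 2) (Fin 2) ℝ} (h : 0 < charDisc c) :
    ∃ a b : ℝ, b < a ∧ a + b = c.trace ∧ a * b = c.det := by
  have h1 := Real.sqrt_pos.2 h
  have h2 := Real.sq_sqrt h.le
  rw [charDisc_eq] at h2
  refine ⟨(c.trace + √(charDisc c)) / 2, (c.trace - √(charDisc c)) / 2, by linarith, by ring, ?_⟩
  rw [charDisc_eq]
  linear_combination -(1 / 4) * h2

lemma exists_conj_spiral {c : Matrix (Fin 2) (Fin 2) ℝ} (h : charDisc c < 0) :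
    ∃ b : ℝ, 0 < b ∧ ∃ S T : Matrix (Fin 2) (Fin 2) ℝ, S * T = 1 ∧
      c * T = T * !![c.trace / 2, -b; b, c.trace / 2] := by
  have hd : 0 < -charDisc c := by linarith
  have h1 := Real.sqrt_pos.2 hd
  have h2 := Real.sq_sqrt hd.le
  set w := √(-charDisc c) with hw
  have hr : c 1 0 ≠ 0 := by
    intro h0
    rw [charDisc, h0] at h
    nlinarith [sq_nonneg (c 0 0 - c 1 1)]
  refine ⟨w / 2, by positivity, ?_⟩
  suffices h : ∃ T : Matrix (Fin 2) (Fin 2) ℝ, T.det ≠ 0 ∧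
      c * T = T * !![c.trace / 2, -(w / 2); w / 2, c.trace / 2] by
    obtain ⟨T, hT, h⟩ := h
    exact ⟨T⁻¹, T, Matrix.nonsing_inv_mul _ (isUnit_iff_ne_zero.2 hT), h⟩
  -- The columns are the imaginary and real parts of the eigenvector (c₀₀ - c₁₁ + iw, 2c₁₀) for the
  -- eigenvalue (tr + iw)/2.
  refine ⟨!![w, c 0 0 - c 1 1; 0, 2 * c 1 0], ?_, ?_⟩
  · rw [Matrix.det_fin_two_of]
    have := mul_ne_zero h1.ne' hr
    intro h
    apply this
    linear_combination h / 2
  · rw [charDisc] at h2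
    rw [Matrix.trace_fin_two]
    ext i j
    fin_cases i <;> fin_cases j <;> simp [Matrix.mul_apply]
    · ring
    · linear_combination h2 / 2
    · ring
    · ring

/-! ### Sufficient conditions for each portrait. -/

/-- The matrices of the fields with a given portrait. -/
def LinearPortrait.Realizes : LinearPortrait → Matrix (Fin 2) (Fin 2) ℝ → Prop
  | .saddle, c => c.det < 0
  | .node, c => 0 < c.det ∧ 0 < charDisc c
  | .focus, c => charDisc c < 0 ∧ c.trace ≠ 0

lemma hasPortrait_saddle {c : Matrix (Fin 2) (Fin 2) ℝ} (h : c.det < 0) :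
    HasPortrait (linearField c) .saddle := by
  have hd : 0 < charDisc c := by
    rw [charDisc_eq]
    nlinarith [sq_nonneg c.trace]
  obtain ⟨a, b, hab, htr, hdet⟩ := exists_roots hd
  obtain ⟨S, T, hST, hT⟩ := exists_conj_diag hab.ne' htr hdet
  refine Or.inl ((orientedEquivalent_of_conj hST hT).symm.trans
    (orientedEquivalent_saddle ?_ ?_))
  · by_contra! h0
    nlinarith
  · by_contra! h0
    nlinarith

lemma orientedEquivalent_node_of_trace_neg {c : Matrix (Fin 2) (Fin 2) ℝ} (h : 0 < c.det)
    (hd : 0 < charDisc c) (htr : c.trace < 0) :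
    OrientedEquivalent (linearField c) (linearField LinearPortrait.node.model) := by
  obtain ⟨a, b, hab, htr', hdet⟩ := exists_roots hd
  obtain ⟨S, T, hST, hT⟩ := exists_conj_diag hab.ne' htr' hdet
  refine (orientedEquivalent_of_conj hST hT).symm.trans (orientedEquivalent_node ?_ hab)
  by_contra! h0
  nlinarith

lemma orientedEquivalent_focus_of_trace_neg {c : Matrix (Fin 2) (Fin 2) ℝ}
    (hd : charDisc c < 0) (htr : c.trace < 0) :
    OrientedEquivalent (linearField c) (linearField LinearPortrait.focus.model) := by
  obtain ⟨b, hb, S, T, hST, hT⟩ := exists_conj_spiral hd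
  exact (orientedEquivalent_of_conj hST hT).symm.trans
    (orientedEquivalent_focus (by linarith) hb)

lemma orientedEquivalent_neg_of_neg {c : Matrix (Fin 2) (Fin 2) ℝ} {g : Plane → Plane}
    (h : OrientedEquivalent (linearField (-c)) g) : OrientedEquivalent (linearField c) (-g) := by
  have := h.neg
  rwa [linearField_neg, neg_neg] at this

lemma LinearPortrait.Realizes.hasPortrait {L : LinearPortrait} {c : Matrix (Fin 2) (Fin 2) ℝ}
    (h : L.Realizes c) : HasPortrait (linearField c) L := by
  cases L with
  | saddle => exact hasPortrait_saddle h
  | node =>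
    obtain ⟨h, hd⟩ := h
    have htr : c.trace ≠ 0 := by
      intro h0
      rw [charDisc_eq, h0] at hd
      linarith
    rcases htr.lt_or_gt with h1 | h1
    · exact Or.inl (orientedEquivalent_node_of_trace_neg h hd h1)
    · refine Or.inr (orientedEquivalent_neg_of_neg (orientedEquivalent_node_of_trace_neg ?_ ?_ ?_))
      · rwa [det_neg_two]
      · rwa [charDisc_neg]
      · rw [Matrix.trace_neg]
        linarith
  | focus =>
    obtain ⟨hd, htr⟩ := h
    rcases htr.lt_or_gt with h1 | h1
    · exact Or.inl (orientedEquivalent_focus_of_trace_neg hd h1)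
    · refine Or.inr (orientedEquivalent_neg_of_neg (orientedEquivalent_focus_of_trace_neg ?_ ?_))
      · rwa [charDisc_neg]
      · rw [Matrix.trace_neg]
        linarith

/-! ### Zeros of the compactified field -/

/-- Zeros are the points whose orbit is a single point, a property visible to orbit-preserving
homeomorphisms. -/
lemma poincareField_eq_zero_iff_of_hom {c d : Matrix (Fin 2) (Fin 2) ℝ}
    {h : PoincareDisk ≃ₜ PoincareDisk}
    (ho : ∀ γ : ℝ → PoincareDisk,
      IsSolution (poincareField (linearField c)) (fun t => (γ t : Plane)) →
      ∃ δ : ℝ → PoincareDisk, IsSolution (poincareField (linearField d)) (fun t => (δ t : Plane)) ∧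
        ∃ σ : ℝ ≃o ℝ, ∀ t : ℝ, h (γ t) = δ (σ t)) (u : PoincareDisk) :
    poincareField (linearField c) u = 0 ↔ poincareField (linearField d) (h u) = 0 := by
  have hconst : ∀ (f : Plane → Plane) (v : PoincareDisk), poincareField f v = 0 →
      IsSolution (poincareField f) fun _ => (v : Plane) := fun f v hv t => by
    simpa [hv] using hasDerivAt_const t (v : Plane)
  constructor
  · intro hu
    obtain ⟨δ, hδ, σ, hσ⟩ := ho (fun _ => u) (hconst _ u hu)
    have h1 : δ = fun _ => h u := by
      funext s
      rw [hσ (σ.symm s), σ.apply_symm_apply]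
    subst h1
    exact (hδ 0).unique (hasDerivAt_const 0 (h u : Plane))
  · intro hu
    obtain ⟨γ, hγ, h0⟩ := exists_disk_solution c u
    obtain ⟨δ, hδ, σ, hσ⟩ := ho γ hγ
    have h1 : δ = fun _ => h u :=
      hδ.disk_eq_of_eq (hconst _ _ hu) (t₀ := σ 0) (by rw [← hσ, h0])
    have h2 : γ = fun _ => u := by
      funext t
      apply h.injective
      rw [hσ, h1]
    subst h2
    exact (hγ 0).unique (hasDerivAt_const 0 (u : Plane))

lemma SamePortrait.exists_homeomorph {c d : Matrix (Fin 2) (Fin 2) ℝ}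
    (h : SamePortrait (linearField c) (linearField d)) :
    ∃ h : PoincareDisk ≃ₜ PoincareDisk,
      (∀ u : PoincareDisk, ‖(u : Plane)‖ = 1 ↔ ‖(h u : Plane)‖ = 1) ∧
      ∀ u : PoincareDisk,
        poincareField (linearField c) u = 0 ↔ poincareField (linearField d) (h u) = 0 := by
  rcases h with ⟨h, hn, ho⟩ | ⟨h, hn, ho⟩
  · exact ⟨h, hn, poincareField_eq_zero_iff_of_hom ho⟩
  · refine ⟨h, hn, fun u => ?_⟩
    rw [← linearField_neg] at ho
    rw [poincareField_eq_zero_iff_of_hom ho, linearField_neg, poincareField_neg, Pi.neg_apply,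
      neg_eq_zero]

lemma linearField_eq_zero_iff {c : Matrix (Fin 2) (Fin 2) ℝ} (hc : c.det ≠ 0) {x : Plane} :
    linearField c x = 0 ↔ x = 0 := by
  refine ⟨fun h => ?_, fun h => by rw [h, linearField_zero]⟩
  by_contra hx
  exact linearField_ne_zero (Matrix.nonsing_inv_mul c (isUnit_iff_ne_zero.2 hc)) hx h

lemma exists_linearField_eq_zero {c : Matrix (Fin 2) (Fin 2) ℝ} (hc : c.det = 0) :
    ∃ x : Plane, x ≠ 0 ∧ linearField c x = 0 := by
  rw [Matrix.det_fin_two] at hc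
  by_cases h : c 0 0 = 0 ∧ c 0 1 = 0
  · by_cases h' : c 1 0 = 0 ∧ c 1 1 = 0
    · refine ⟨!₂[1, 0], fun h0 => ?_, plane_ext ?_ ?_⟩
      · simpa using congrArg (fun v : Plane => v 0) h0
      · simp [linearField, h.1]
      · simp [linearField, h'.1]
    · refine ⟨!₂[c 1 1, -c 1 0], fun h0 => h' ⟨?_, ?_⟩, plane_ext ?_ ?_⟩
      · simpa using congrArg (fun v : Plane => v 1) h0
      · simpa using congrArg (fun v : Plane => v 0) h0
      · simp [linearField, h.1, h.2]
      · simp [linearField]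
        ring
  · refine ⟨!₂[c 0 1, -c 0 0], fun h0 => h ⟨?_, ?_⟩, plane_ext ?_ ?_⟩
    · simpa using congrArg (fun v : Plane => v 1) h0
    · simpa using congrArg (fun v : Plane => v 0) h0
    · simp [linearField]
      ring
    · simp [linearField]
      linear_combination -hc

/-- Pairing with u gives (1 - ‖u‖²)⟨u, f u⟩ = 0, so away from the circle the radial correction
vanishes. -/
lemma poincareField_eq_zero_of_norm_ne_one {f : Plane → Plane} {u : Plane} (hu : ‖u‖ ≠ 1)
    (h : poincareField f u = 0) : f u = 0 := by
  have h1 : f u = inner ℝ u (f u) • u := sub_eq_zero.1 h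
  have h2 : inner ℝ u (f u) = inner ℝ u (f u) * ‖u‖ ^ 2 := by
    conv_lhs => rw [h1]
    rw [inner_smul_right, real_inner_self_eq_norm_sq]
  have h3 : (1 - ‖u‖) * (1 + ‖u‖) ≠ 0 :=
    mul_ne_zero (sub_ne_zero.2 hu.symm) (by positivity)
  have h4 : inner ℝ u (f u) * ((1 - ‖u‖) * (1 + ‖u‖)) = 0 := by linear_combination h2
  rw [h1, (mul_eq_zero.1 h4).resolve_right h3, zero_smul]

/-- The centre of the disk. -/
noncomputable def diskCenter : PoincareDisk := ⟨0, by simp⟩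

@[simp]
lemma coe_diskCenter : (diskCenter : Plane) = 0 := rfl

lemma poincareField_center (c : Matrix (Fin 2) (Fin 2) ℝ) :
    poincareField (linearField c) diskCenter = 0 := by
  simp [poincareField]

lemma eq_diskCenter {c : Matrix (Fin 2) (Fin 2) ℝ} (hc : c.det ≠ 0) {u : PoincareDisk}
    (hu : ‖(u : Plane)‖ ≠ 1) (h : poincareField (linearField c) u = 0) : u = diskCenter :=
  Subtype.ext ((linearField_eq_zero_iff hc).1 (poincareField_eq_zero_of_norm_ne_one hu h))

/-- A singular matrix has a kernel vector, hence an interior zero besides the centre, while for a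
nonsingular one the centre is the only interior zero. -/
lemma SamePortrait.det_ne_zero {c d : Matrix (Fin 2) (Fin 2) ℝ}
    (h : SamePortrait (linearField c) (linearField d)) (hd : d.det ≠ 0) : c.det ≠ 0 := by
  intro hc
  obtain ⟨h, hn, hz⟩ := h.exists_homeomorph
  have key : ∀ u : PoincareDisk, ‖(u : Plane)‖ ≠ 1 → poincareField (linearField c) u = 0 →
      h u = diskCenter := fun u hu h0 => eq_diskCenter hd ((hn u).not.1 hu) ((hz u).1 h0)
  obtain ⟨x, hx, h0⟩ := exists_linearField_eq_zero hc
  have hne : x ≠ 0 ∨ (1 : ℝ) ≠ 0 := Or.inl hx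
  have h1 : poincareField (linearField c) (diskPoint x 1) = 0 := by
    rw [poincareField, coe_diskPoint, compactify, linearField_smul, h0]
    simp
  have h2 := key (diskPoint x 1) ((norm_compactify_eq_one_iff hne).not.2 one_ne_zero) h1
  have h3 := key diskCenter (by simp) (poincareField_center c)
  have h4 := congrArg Subtype.val (h.injective (h2.trans h3.symm))
  have h5 : (√(‖x‖ ^ 2 + 1 ^ 2))⁻¹ • x = 0 := h4
  exact smul_ne_zero (inv_ne_zero (Real.sqrt_pos.2 (compactify_den_pos hne)).ne') hx h5

lemma inner_plane (x y : Plane) : inner ℝ x y = x 0 * y 0 + x 1 * y 1 := by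
  simp [PiLp.inner_apply]
  ring

/-- The zeros at infinity are the directions of the eigenvectors. -/
lemma poincareField_eq_zero_iff_cross {f : Plane → Plane} {u : Plane} (hu : ‖u‖ = 1) :
    poincareField f u = 0 ↔ u 0 * f u 1 - u 1 * f u 0 = 0 := by
  have h1 := norm_sq_plane u
  rw [hu] at h1
  constructor
  · intro h
    have h2 : f u = inner ℝ u (f u) • u := sub_eq_zero.1 h
    rw [h2]
    simp
    ring
  · intro h
    refine sub_eq_zero.2 (plane_ext ?_ ?_)
    · simp only [PiLp.smul_apply, smul_eq_mul, inner_plane]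
      linear_combination f u 0 * h1 - u 1 * h
    · simp only [PiLp.smul_apply, smul_eq_mul, inner_plane]
      linear_combination f u 1 * h1 + u 0 * h

/-! ### Zeros at infinity and the sign of the discriminant. -/

/-- The compactified field has a zero at infinity. -/
def HasZeroAtInfinity (f : Plane → Plane) : Prop :=
  ∃ u : PoincareDisk, ‖(u : Plane)‖ = 1 ∧ poincareField f u = 0

/-- The compactified field has at least three zeros at infinity, but does not vanish identically
there. -/
def HasManyZerosAtInfinity (f : Plane → Plane) : Prop :=
  (∃ u v w : PoincareDisk, u ≠ v ∧ u ≠ w ∧ v ≠ w ∧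
    (‖(u : Plane)‖ = 1 ∧ poincareField f u = 0) ∧ (‖(v : Plane)‖ = 1 ∧ poincareField f v = 0) ∧
    (‖(w : Plane)‖ = 1 ∧ poincareField f w = 0)) ∧
  ∃ u : PoincareDisk, ‖(u : Plane)‖ = 1 ∧ poincareField f u ≠ 0

lemma SamePortrait.hasZeroAtInfinity {c d : Matrix (Fin 2) (Fin 2) ℝ}
    (h : SamePortrait (linearField c) (linearField d)) (hc : HasZeroAtInfinity (linearField c)) :
    HasZeroAtInfinity (linearField d) := by
  obtain ⟨h, hn, hz⟩ := h.exists_homeomorph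
  obtain ⟨u, hu, h0⟩ := hc
  exact ⟨h u, (hn u).1 hu, (hz u).1 h0⟩

lemma SamePortrait.hasManyZerosAtInfinity {c d : Matrix (Fin 2) (Fin 2) ℝ}
    (h : SamePortrait (linearField c) (linearField d))
    (hc : HasManyZerosAtInfinity (linearField c)) : HasManyZerosAtInfinity (linearField d) := by
  obtain ⟨h, hn, hz⟩ := h.exists_homeomorph
  obtain ⟨⟨u, v, w, huv, huw, hvw, hu, hv, hw⟩, y, hy, hy0⟩ := hc
  exact ⟨⟨h u, h v, h w, h.injective.ne huv, h.injective.ne huw, h.injective.ne hvw,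
    ⟨(hn u).1 hu.1, (hz u).1 hu.2⟩, ⟨(hn v).1 hv.1, (hz v).1 hv.2⟩,
    ⟨(hn w).1 hw.1, (hz w).1 hw.2⟩⟩, h y, (hn y).1 hy, (hz y).not.1 hy0⟩

lemma norm_eq_one_iff_plane (u : Plane) : ‖u‖ = 1 ↔ u 0 ^ 2 + u 1 ^ 2 = 1 := by
  rw [← norm_sq_plane, pow_eq_one_iff_of_nonneg (norm_nonneg u) two_ne_zero]

/-- The point at infinity with direction `(a, b)`. -/
noncomputable def circlePoint (a b : ℝ) (h : a ^ 2 + b ^ 2 = 1) : PoincareDisk :=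
  ⟨!₂[a, b], mem_closedBall_zero_iff.2 ((norm_eq_one_iff_plane _).2 (by simpa using h)).le⟩

lemma norm_circlePoint {a b : ℝ} (h : a ^ 2 + b ^ 2 = 1) :
    ‖(circlePoint a b h : Plane)‖ = 1 := (norm_eq_one_iff_plane _).2 (by simpa [circlePoint] using h)

lemma poincareField_circlePoint {c : Matrix (Fin 2) (Fin 2) ℝ} {a b : ℝ}
    (h : a ^ 2 + b ^ 2 = 1) : poincareField (linearField c) (circlePoint a b h) = 0 ↔
      a * (c 1 0 * a + c 1 1 * b) - b * (c 0 0 * a + c 0 1 * b) = 0 := by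
  rw [poincareField_eq_zero_iff_cross (norm_circlePoint h)]
  simp [circlePoint, linearField]

lemma circlePoint_ne {a b a' b' : ℝ} {h : a ^ 2 + b ^ 2 = 1} {h' : a' ^ 2 + b' ^ 2 = 1}
    (hne : a ≠ a') : circlePoint a b h ≠ circlePoint a' b' h' := by
  intro he
  apply hne
  simpa [circlePoint] using congrArg (fun v : PoincareDisk => (v : Plane) 0) he

lemma SamePortrait.of_conj {c d S T : Matrix (Fin 2) (Fin 2) ℝ} (hST : S * T = 1)
    (h : d * T = T * c) : SamePortrait (linearField c) (linearField d) :=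
  Or.inl (orientedEquivalent_of_conj hST h)

lemma hasManyZerosAtInfinity_diag {a b : ℝ} (hab : a ≠ b) :
    HasManyZerosAtInfinity (linearField !![a, 0; 0, b]) := by
  -- The axes are eigenlines. The last point is a rational direction off both axes, where the form
  -- equals 12(b - a)/25.
  refine ⟨⟨circlePoint 1 0 (by norm_num), circlePoint (-1) 0 (by norm_num),
    circlePoint 0 1 (by norm_num), circlePoint_ne (by norm_num), circlePoint_ne (by norm_num),
    circlePoint_ne (by norm_num), ⟨norm_circlePoint _, ?_⟩, ⟨norm_circlePoint _, ?_⟩,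
    ⟨norm_circlePoint _, ?_⟩⟩, circlePoint (3 / 5) (4 / 5) (by norm_num), norm_circlePoint _, ?_⟩
  · rw [poincareField_circlePoint]
    simp
  · rw [poincareField_circlePoint]
    simp
  · rw [poincareField_circlePoint]
    simp
  · rw [Ne, poincareField_circlePoint]
    intro h
    apply hab
    simp at h
    linarith

lemma hasManyZerosAtInfinity_of_charDisc_pos {c : Matrix (Fin 2) (Fin 2) ℝ}
    (h : 0 < charDisc c) : HasManyZerosAtInfinity (linearField c) := by
  obtain ⟨a, b, hab, htr, hdet⟩ := exists_roots h
  obtain ⟨S, T, hST, hT⟩ := exists_conj_diag hab.ne' htr hdet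
  exact (SamePortrait.of_conj hST hT).hasManyZerosAtInfinity (hasManyZerosAtInfinity_diag hab.ne')

lemma not_hasZeroAtInfinity_of_charDisc_neg {c : Matrix (Fin 2) (Fin 2) ℝ}
    (h : charDisc c < 0) : ¬HasZeroAtInfinity (linearField c) := by
  rintro ⟨u, hu, h0⟩
  rw [poincareField_eq_zero_iff_cross hu] at h0
  rw [norm_eq_one_iff_plane] at hu
  simp only [linearField, Matrix.cons_val] at h0
  rw [charDisc] at h
  set x := (u : Plane) 0
  set y := (u : Plane) 1
  -- The square is completed in each variable; adding the two identities on the unit circle shows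
  -- the discriminant to be a sum of squares without dividing by an entry.
  have k1 : charDisc c * y ^ 2 = (2 * c 1 0 * x + (c 1 1 - c 0 0) * y) ^ 2 := by
    rw [charDisc]
    linear_combination -4 * c 1 0 * h0
  have k2 : charDisc c * x ^ 2 = (2 * c 0 1 * y + (c 0 0 - c 1 1) * x) ^ 2 := by
    rw [charDisc]
    linear_combination 4 * c 0 1 * h0
  have k3 : charDisc c = (2 * c 1 0 * x + (c 1 1 - c 0 0) * y) ^ 2 +
      (2 * c 0 1 * y + (c 0 0 - c 1 1) * x) ^ 2 := by
    linear_combination k1 + k2 - charDisc c * hu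
  rw [charDisc] at k3
  nlinarith [sq_nonneg (2 * c 1 0 * x + (c 1 1 - c 0 0) * y),
    sq_nonneg (2 * c 0 1 * y + (c 0 0 - c 1 1) * x)]

lemma HasManyZerosAtInfinity.hasZeroAtInfinity {f : Plane → Plane}
    (h : HasManyZerosAtInfinity f) : HasZeroAtInfinity f := by
  obtain ⟨⟨u, -, -, -, -, -, hu, -⟩, -⟩ := h
  exact ⟨u, hu⟩

/-- The quadratic form whose isotropic lines are the eigenlines, when the discriminant vanishes. -/
lemma charDisc_eq_zero_cases {c : Matrix (Fin 2) (Fin 2) ℝ} (h : charDisc c = 0) :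
    ∃ k l m : ℝ, ∀ x y : ℝ, x * (c 1 0 * x + c 1 1 * y) - y * (c 0 0 * x + c 0 1 * y) =
      k * (l * x + m * y) ^ 2 ∧ (l ≠ 0 ∨ m ≠ 0) := by
  rw [charDisc] at h
  by_cases hr : c 1 0 = 0
  · refine ⟨-c 0 1, 0, 1, fun x y => ⟨?_, by simp⟩⟩
    have : c 0 0 - c 1 1 = 0 := by
      rw [hr] at h
      simpa using h
    rw [hr]
    linear_combination -(x * y) * this
  · refine ⟨(4 * c 1 0)⁻¹, 2 * c 1 0, c 1 1 - c 0 0, fun x y => ⟨?_, by simp [hr]⟩⟩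
    field_simp
    linear_combination -y ^ 2 * h

/-- The form k(lx + my)² vanishes either on the whole circle or on one line only, that is, at two
antipodal points. The nonvanishing clause of `HasManyZerosAtInfinity` is there to exclude the scalar
matrices. -/
lemma not_hasManyZerosAtInfinity_of_charDisc_eq_zero {c : Matrix (Fin 2) (Fin 2) ℝ}
    (h : charDisc c = 0) : ¬HasManyZerosAtInfinity (linearField c) := by
  obtain ⟨k, l, m, hq⟩ := charDisc_eq_zero_cases h
  have hcross : ∀ u : PoincareDisk, ‖(u : Plane)‖ = 1 → (poincareField (linearField c) u = 0 ↔
      k * (l * (u : Plane) 0 + m * (u : Plane) 1) ^ 2 = 0) := fun u hu => by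
    rw [poincareField_eq_zero_iff_cross hu, ← (hq _ _).1]
    simp [linearField]
  rintro ⟨⟨u, v, w, huv, huw, hvw, hu, hv, hw⟩, y, hy, hy0⟩
  have hk : k ≠ 0 := by
    rintro rfl
    exact hy0 ((hcross y hy).2 (zero_mul _))
  have hlm : 0 < l ^ 2 + m ^ 2 := by
    rcases (hq 0 0).2 with h | h <;> positivity
  -- a zero is `s • (-m, l)` with `s ^ 2 (l ^ 2 + m ^ 2) = 1`
  have key : ∀ u : PoincareDisk, ‖(u : Plane)‖ = 1 ∧ poincareField (linearField c) u = 0 →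
      ∃ s : ℝ, s ^ 2 * (l ^ 2 + m ^ 2) = 1 ∧ (u : Plane) = s • !₂[-m, l] := by
    rintro u ⟨hu, h0⟩
    have h1 : l * (u : Plane) 0 + m * (u : Plane) 1 = 0 :=
      pow_eq_zero_iff two_ne_zero |>.1 ((mul_eq_zero.1 ((hcross u hu).1 h0)).resolve_left hk)
    rw [norm_eq_one_iff_plane] at hu
    refine ⟨(l * (u : Plane) 1 - m * (u : Plane) 0) / (l ^ 2 + m ^ 2), ?_, plane_ext ?_ ?_⟩
    · field_simp
      linear_combination (l ^ 2 + m ^ 2) * hu - (l * (u : Plane) 0 + m * (u : Plane) 1) * h1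
    · simp
      field_simp
      linear_combination l * h1
    · simp
      field_simp
      linear_combination m * h1
  obtain ⟨r, hr, hr'⟩ := key u hu
  obtain ⟨s, hs, hs'⟩ := key v hv
  obtain ⟨t, ht, ht'⟩ := key w hw
  have hsq : ∀ a b : ℝ, a ^ 2 * (l ^ 2 + m ^ 2) = 1 → b ^ 2 * (l ^ 2 + m ^ 2) = 1 →
      a = b ∨ a = -b := fun a b ha hb =>
    sq_eq_sq_iff_eq_or_eq_neg.1 (mul_right_cancel₀ hlm.ne' (ha.trans hb.symm))
  have hne : ∀ {p q : PoincareDisk} {a b : ℝ}, p ≠ q → (p : Plane) = a • !₂[-m, l] →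
      (q : Plane) = b • !₂[-m, l] → a ≠ b := by
    rintro p q a b hpq hp hq rfl
    exact hpq (Subtype.ext (hp.trans hq.symm))
  have h1 := (hsq r s hr hs).resolve_left (hne huv hr' hs')
  have h2 := (hsq r t hr ht).resolve_left (hne huw hr' ht')
  exact hne hvw hs' ht' (by linarith)

lemma hasZeroAtInfinity_iff {c : Matrix (Fin 2) (Fin 2) ℝ} :
    HasZeroAtInfinity (linearField c) ↔ 0 ≤ charDisc c := by
  constructor
  · intro h
    by_contra! h0
    exact not_hasZeroAtInfinity_of_charDisc_neg h0 h
  · intro h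
    rcases h.lt_or_eq with h | h
    · exact (hasManyZerosAtInfinity_of_charDisc_pos h).hasZeroAtInfinity
    · obtain ⟨k, l, m, hq⟩ := charDisc_eq_zero_cases h.symm
      have hlm : 0 < l ^ 2 + m ^ 2 := by
        rcases (hq 0 0).2 with h | h <;> positivity
      have hs := Real.sq_sqrt hlm.le
      have hs0 := Real.sqrt_pos.2 hlm
      have hcirc : (-m / √(l ^ 2 + m ^ 2)) ^ 2 + (l / √(l ^ 2 + m ^ 2)) ^ 2 = 1 := by
        rw [div_pow, div_pow, hs]
        field_simp
        ring
      refine ⟨circlePoint _ _ hcirc, norm_circlePoint _, ?_⟩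
      rw [poincareField_circlePoint, (hq _ _).1]
      field_simp
      ring

lemma hasManyZerosAtInfinity_iff {c : Matrix (Fin 2) (Fin 2) ℝ} :
    HasManyZerosAtInfinity (linearField c) ↔ 0 < charDisc c := by
  refine ⟨fun h => ?_, hasManyZerosAtInfinity_of_charDisc_pos⟩
  rcases (hasZeroAtInfinity_iff.1 h.hasZeroAtInfinity).lt_or_eq with h0 | h0
  · exact h0
  · exact absurd h (not_hasManyZerosAtInfinity_of_charDisc_eq_zero h0.symm)

/-! ### Attractors and repellers -/

lemma isGlobalRepeller_iff_neg (f : Plane → Plane) :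
    IsGlobalRepeller f ↔ IsGlobalAttractor (-f) := by
  constructor
  · intro h γ hγ
    have h1 := hγ.comp_neg
    rw [neg_neg] at h1
    simpa [Function.comp_def] using (h _ h1).comp tendsto_neg_atTop_atBot
  · intro h γ hγ
    simpa [Function.comp_def] using (h _ hγ.comp_neg).comp tendsto_neg_atBot_atTop

/-- All the interior solutions in the disk tend to the centre. -/
def IsDiskAttractor (f : Plane → Plane) : Prop :=
  ∀ γ : ℝ → PoincareDisk, IsSolution (poincareField f) (fun t => (γ t : Plane)) →
    ‖(γ 0 : Plane)‖ ≠ 1 → Tendsto γ atTop (𝓝 diskCenter)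

/-- Interior orbits correspond to planar ones with a fixed height z ≠ 0, and both the projection and
its inverse u ↦ u / `height u` are continuous near the centre. Attraction thus becomes a property of
the disk flow, where equivalences act. -/
lemma isDiskAttractor_iff (c : Matrix (Fin 2) (Fin 2) ℝ) :
    IsDiskAttractor (linearField c) ↔ IsGlobalAttractor (linearField c) := by
  constructor
  · intro h η hη
    have hne : ∀ t, η t ≠ 0 ∨ (1 : ℝ) ≠ 0 := fun t => Or.inr one_ne_zero
    have h1 := h (fun t => diskPoint (η t) 1) (hη.compactify (hne 0))
      ((norm_compactify_eq_one_iff (hne 0)).not.2 one_ne_zero)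
    have h2 : ∀ t, η t = (height (diskPoint (η t) 1))⁻¹ • (diskPoint (η t) 1 : Plane) := by
      intro t
      have h3 := (Real.sqrt_pos.2 (compactify_den_pos (hne t))).ne'
      rw [coe_diskPoint, height_compactify zero_le_one (hne t), mul_one, inv_inv, compactify,
        smul_smul, mul_inv_cancel₀ h3, one_smul]
    have h4 : ContinuousAt (fun u : PoincareDisk => (height u)⁻¹ • (u : Plane)) diskCenter := by
      refine ((continuous_height.comp continuous_subtype_val).continuousAt.inv₀ ?_).smul
        continuous_subtype_val.continuousAt
      simp [height]
    have h5 := h4.tendsto.comp h1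
    simp only [coe_diskCenter, smul_zero] at h5
    exact h5.congr fun t => (h2 t).symm
  · intro h γ hγ h0
    obtain ⟨η, hη, hη0⟩ := exists_isSolution_linearField c (γ 0)
    have hz : height (γ 0) ≠ 0 := (height_eq_zero_iff (γ 0).norm_le).not.2 h0
    have h1 : γ = fun t => diskPoint (η t) (height (γ 0)) :=
      funext fun t => hγ.eq_diskPoint hη hη0 t
    rw [h1, tendsto_subtype_rng]
    have h2 : ContinuousAt (fun p : Plane × ℝ => compactify p.1 p.2) (0, height (γ 0)) := by
      refine continuousOn_compactify.continuousAt (IsOpen.mem_nhds ?_ (Or.inr hz))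
      exact (isOpen_ne_fun continuous_fst continuous_const).union
        (isOpen_ne_fun continuous_snd continuous_const)
    have h3 := h2.tendsto.comp ((h η hη).prodMk_nhds tendsto_const_nhds)
    simpa [compactify, Function.comp_def] using h3

/-- Nonsingularity of d makes the centre its only interior zero, which forces the homeomorphism to
fix the centre; convergence is then pulled back, since σ tends to infinity with t. -/
lemma OrientedEquivalent.isGlobalAttractor {c d : Matrix (Fin 2) (Fin 2) ℝ}
    (h : OrientedEquivalent (linearField c) (linearField d)) (hd : d.det ≠ 0)
    (hattr : IsGlobalAttractor (linearField d)) : IsGlobalAttractor (linearField c) := by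
  rw [← isDiskAttractor_iff] at hattr ⊢
  obtain ⟨h, hn, ho⟩ := h
  have hcenter : h diskCenter = diskCenter :=
    eq_diskCenter hd ((hn _).not.1 (by simp))
      ((poincareField_eq_zero_iff_of_hom ho _).1 (poincareField_center c))
  intro γ hγ h0
  obtain ⟨δ, hδ, σ, hσ⟩ := ho γ hγ
  have h1 : Tendsto (fun t => δ (t + σ 0)) atTop (𝓝 diskCenter) := by
    refine hattr _ (hδ.comp_add (σ 0)) ?_
    rw [zero_add, ← hσ]
    exact (hn _).not.1 h0
  have h2 : Tendsto (fun t => h (γ t)) atTop (𝓝 diskCenter) := by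
    have h3 : Tendsto (fun t => σ t + -σ 0) atTop atTop :=
      tendsto_atTop_add_const_right _ _ σ.tendsto_atTop
    refine (h1.comp h3).congr fun t => ?_
    simp [hσ]
  have h3 := (h.symm.continuous.tendsto diskCenter).comp h2
  rw [h.symm_apply_eq.2 hcenter.symm] at h3
  simpa [Function.comp_def] using h3

/-- Reversing time exchanges the two alternatives, so only their disjunction is an invariant of the
portrait. -/
lemma SamePortrait.attractor_or_repeller {c d : Matrix (Fin 2) (Fin 2) ℝ}
    (h : SamePortrait (linearField c) (linearField d)) (hd : d.det ≠ 0)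
    (hattr : IsGlobalAttractor (linearField d) ∨ IsGlobalRepeller (linearField d)) :
    IsGlobalAttractor (linearField c) ∨ IsGlobalRepeller (linearField c) := by
  simp only [isGlobalRepeller_iff_neg] at hattr ⊢
  have hd' : (-d).det ≠ 0 := by rwa [det_neg_two]
  rcases h with h | h
  · have h' := h.neg
    rw [← linearField_neg] at hattr ⊢
    rw [← linearField_neg, ← linearField_neg] at h'
    exact hattr.imp (h.isGlobalAttractor hd) (h'.isGlobalAttractor hd')
  · have h' := h.neg
    rw [neg_neg, ← linearField_neg] at h'
    rw [← linearField_neg] at hattr h ⊢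
    exact hattr.symm.imp (h.isGlobalAttractor hd') (h'.isGlobalAttractor hd)

lemma tendsto_exp_mul_zero_iff {a : ℝ} :
    Tendsto (fun t : ℝ => Real.exp (a * t)) atTop (𝓝 0) ↔ a < 0 := by
  rw [Real.tendsto_exp_comp_nhds_zero]
  constructor
  · intro h
    by_contra! ha
    obtain ⟨t, h1, h2⟩ := ((h.eventually_lt_atBot 0).and (eventually_ge_atTop 0)).exists
    exact absurd (mul_nonneg ha h2) (not_le.2 h1)
  · intro h
    exact tendsto_id.const_mul_atTop_of_neg h

lemma isGlobalAttractor_diag_iff {a b : ℝ} :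
    IsGlobalAttractor (linearField !![a, 0; 0, b]) ↔ a < 0 ∧ b < 0 := by
  constructor
  · intro h
    have h1 := h _ (isSolution_diagSolution a b !₂[1, 1])
    have hc : ∀ i : Fin 2, Continuous fun v : Plane => v i := fun i => by fun_prop
    have k0 := ((hc 0).tendsto 0).comp h1
    have k1 := ((hc 1).tendsto 0).comp h1
    simp only [Function.comp_def, diagSolution, Matrix.cons_val, mul_one, PiLp.zero_apply]
      at k0 k1
    exact ⟨tendsto_exp_mul_zero_iff.1 k0, tendsto_exp_mul_zero_iff.1 k1⟩
  · rintro ⟨ha, hb⟩ η hη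
    obtain ⟨x, rfl⟩ : ∃ x, η = diagSolution a b x := ⟨η 0,
      hη.eq_of_eq (isSolution_diagSolution a b _) (t₀ := 0) (diagSolution_zero a b _).symm⟩
    have h1 : Tendsto (fun t => ![Real.exp (a * t) * x 0, Real.exp (b * t) * x 1]) atTop
        (𝓝 ![0, 0]) := by
      rw [tendsto_pi_nhds]
      intro i
      fin_cases i
      · simpa using (tendsto_exp_mul_zero_iff.2 ha).mul_const (x 0)
      · simpa using (tendsto_exp_mul_zero_iff.2 hb).mul_const (x 1)
    have h2 := ((PiLp.continuous_toLp 2 (fun _ : Fin 2 => ℝ)).tendsto ![0, 0]).comp h1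
    have h3 : WithLp.toLp 2 ![(0 : ℝ), 0] = (0 : Plane) := plane_ext rfl rfl
    rw [h3] at h2
    exact h2

lemma isGlobalAttractor_spiral_iff {a b : ℝ} :
    IsGlobalAttractor (linearField !![a, -b; b, a]) ↔ a < 0 := by
  constructor
  · intro h
    have h1 := (h _ (isSolution_spiral a b !₂[1, 0])).norm
    have h2 : ‖(!₂[1, 0] : Plane)‖ = 1 := (norm_eq_one_iff_plane _).2 (by simp)
    simp only [norm_spiral, h2, mul_one, norm_zero] at h1
    exact tendsto_exp_mul_zero_iff.1 h1
  · intro ha η hη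
    obtain ⟨x, rfl⟩ : ∃ x, η = spiral a b x := ⟨η 0,
      hη.eq_of_eq (isSolution_spiral a b _) (t₀ := 0) (spiral_zero a b _).symm⟩
    rw [tendsto_zero_iff_norm_tendsto_zero]
    simp only [norm_spiral]
    simpa using (tendsto_exp_mul_zero_iff.2 ha).mul_const ‖x‖

lemma det_ne_zero_of_conj {c d S T : Matrix (Fin 2) (Fin 2) ℝ} (hST : S * T = 1)
    (h : c * T = T * d) (hc : c.det ≠ 0) : d.det ≠ 0 := by
  intro h0
  have hT : T.det ≠ 0 := by
    intro h1
    have := congrArg Matrix.det hST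
    simp [h1] at this
  have := congrArg Matrix.det h
  rw [Matrix.det_mul, Matrix.det_mul, h0, mul_zero] at this
  exact mul_ne_zero hc hT this

lemma isGlobalAttractor_iff_of_conj {c d S T : Matrix (Fin 2) (Fin 2) ℝ} (hST : S * T = 1)
    (h : c * T = T * d) (hc : c.det ≠ 0) :
    IsGlobalAttractor (linearField c) ↔ IsGlobalAttractor (linearField d) :=
  ⟨(orientedEquivalent_of_conj hST h).isGlobalAttractor hc,
    (orientedEquivalent_of_conj hST h).symm.isGlobalAttractor (det_ne_zero_of_conj hST h hc)⟩

/-- Read off from the diagonal or spiral form. Excluding a vanishing discriminant avoids Jordan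
blocks and costs only a null set later. -/
lemma isGlobalAttractor_iff {c : Matrix (Fin 2) (Fin 2) ℝ} (hc : c.det ≠ 0)
    (hd : charDisc c ≠ 0) : IsGlobalAttractor (linearField c) ↔ 0 < c.det ∧ c.trace < 0 := by
  rcases hd.lt_or_gt with hd | hd
  · obtain ⟨b, -, S, T, hST, hT⟩ := exists_conj_spiral hd
    rw [isGlobalAttractor_iff_of_conj hST hT hc, isGlobalAttractor_spiral_iff]
    rw [charDisc_eq] at hd
    constructor
    · intro h
      exact ⟨by nlinarith [sq_nonneg c.trace], by linarith⟩
    · rintro ⟨-, h⟩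
      linarith
  · obtain ⟨a, b, hab, htr, hdet⟩ := exists_roots hd
    obtain ⟨S, T, hST, hT⟩ := exists_conj_diag hab.ne' htr hdet
    rw [isGlobalAttractor_iff_of_conj hST hT hc, isGlobalAttractor_diag_iff, ← htr, ← hdet]
    constructor
    · rintro ⟨ha, hb⟩
      exact ⟨mul_pos_of_neg_of_neg ha hb, by linarith⟩
    · rintro ⟨h1, h2⟩
      have hb : b < 0 := by linarith
      exact ⟨neg_of_mul_pos_left h1 hb.le, hb⟩

lemma isGlobalRepeller_iff {c : Matrix (Fin 2) (Fin 2) ℝ} (hc : c.det ≠ 0)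
    (hd : charDisc c ≠ 0) : IsGlobalRepeller (linearField c) ↔ 0 < c.det ∧ 0 < c.trace := by
  rw [isGlobalRepeller_iff_neg, ← linearField_neg, isGlobalAttractor_iff, det_neg_two,
    Matrix.trace_neg, neg_lt_zero]
  · rwa [det_neg_two]
  · rwa [charDisc_neg]

/-! ### Fields with a given portrait -/

lemma LinearPortrait.Realizes.det_ne_zero {L : LinearPortrait} {c : Matrix (Fin 2) (Fin 2) ℝ}
    (h : L.Realizes c) : c.det ≠ 0 := by
  cases L with
  | saddle => exact ne_of_lt h
  | node => exact h.1.ne'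
  | focus =>
    have h1 := h.1
    rw [charDisc_eq] at h1
    nlinarith [sq_nonneg c.trace]

lemma LinearPortrait.Realizes.charDisc_ne_zero {L : LinearPortrait}
    {c : Matrix (Fin 2) (Fin 2) ℝ} (h : L.Realizes c) : charDisc c ≠ 0 := by
  cases L with
  | saddle =>
    have h1 : c.det < 0 := h
    rw [charDisc_eq]
    nlinarith [sq_nonneg c.trace]
  | node => exact h.2.ne'
  | focus => exact h.1.ne

lemma attractor_or_repeller_iff {c : Matrix (Fin 2) (Fin 2) ℝ} (hc : c.det ≠ 0)
    (hd : charDisc c ≠ 0) : IsGlobalAttractor (linearField c) ∨ IsGlobalRepeller (linearField c) ↔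
      0 < c.det ∧ c.trace ≠ 0 := by
  rw [isGlobalAttractor_iff hc hd, isGlobalRepeller_iff hc hd, ← and_or_left, lt_or_lt_iff_ne]

/-- The invariants (singularity, zeros at infinity, attraction or repulsion) translate back into the
signs of det and disc and the nonvanishing of tr. -/
lemma LinearPortrait.Realizes.of_samePortrait {L : LinearPortrait}
    {c d : Matrix (Fin 2) (Fin 2) ℝ} (hd : L.Realizes d)
    (h : SamePortrait (linearField c) (linearField d)) : L.Realizes c := by
  have hd0 := hd.det_ne_zero
  have hc0 := h.det_ne_zero hd0
  have hzero : 0 ≤ charDisc c ↔ 0 ≤ charDisc d := by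
    rw [← hasZeroAtInfinity_iff, ← hasZeroAtInfinity_iff]
    exact ⟨h.hasZeroAtInfinity, h.symm.hasZeroAtInfinity⟩
  have hmany : 0 < charDisc c ↔ 0 < charDisc d := by
    rw [← hasManyZerosAtInfinity_iff, ← hasManyZerosAtInfinity_iff]
    exact ⟨h.hasManyZerosAtInfinity, h.symm.hasManyZerosAtInfinity⟩
  -- A zero discriminant means zeros at infinity without `HasManyZerosAtInfinity`, a combination
  -- that d does not have.
  have hcd : charDisc c ≠ 0 := by
    intro h0
    have h1 := hzero.1 h0.ge
    have h2 := hmany.2 (h1.lt_of_ne' hd.charDisc_ne_zero)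
    exact h2.ne' h0
  have hattr : 0 < c.det ∧ c.trace ≠ 0 ↔ 0 < d.det ∧ d.trace ≠ 0 := by
    rw [← attractor_or_repeller_iff hc0 hcd, ← attractor_or_repeller_iff hd0 hd.charDisc_ne_zero]
    exact ⟨h.symm.attractor_or_repeller hc0, h.attractor_or_repeller hd0⟩
  cases L with
  | saddle =>
    have h1 : d.det < 0 := hd
    have h2 : 0 < charDisc c := by
      rw [hmany, charDisc_eq]
      nlinarith [sq_nonneg d.trace]
    -- If det c > 0, then disc c > 0 forces tr c ≠ 0, so the origin attracts or repels for c and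
    -- hence for d, which would give det d > 0.
    by_contra h3
    have h4 : 0 < c.det := (not_lt.1 h3).lt_of_ne' hc0
    refine h1.not_gt (hattr.1 ⟨h4, fun h5 => ?_⟩).1
    rw [charDisc_eq, h5] at h2
    linarith
  | node =>
    refine ⟨(hattr.2 ⟨hd.1, fun h5 => ?_⟩).1, hmany.2 hd.2⟩
    have h1 := hd.1
    have h2 := hd.2
    rw [charDisc_eq, h5] at h2
    linarith
  | focus =>
    have h1 := hd.1
    refine ⟨not_le.1 (hzero.not.2 (not_le.2 h1)), (hattr.2 ⟨?_, hd.2⟩).2⟩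
    rw [charDisc_eq] at h1
    nlinarith [sq_nonneg d.trace]

lemma LinearPortrait.realizes_model (L : LinearPortrait) : L.Realizes L.model := by
  cases L <;> norm_num [Realizes, model, charDisc, Matrix.det_fin_two, Matrix.trace_fin_two]

lemma hasPortrait_iff {L : LinearPortrait} {c : Matrix (Fin 2) (Fin 2) ℝ} :
    HasPortrait (linearField c) L ↔ L.Realizes c :=
  ⟨L.realizes_model.of_samePortrait, fun h => h.hasPortrait⟩

lemma LinearPortrait.Realizes.unique {L L' : LinearPortrait} {c : Matrix (Fin 2) (Fin 2) ℝ}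
    (h : L.Realizes c) (h' : L'.Realizes c) : L = L' := by
  have aux : charDisc c < 0 → 0 < c.det := fun h0 => by
    rw [charDisc_eq] at h0
    nlinarith [sq_nonneg c.trace]
  cases L <;> cases L' <;> simp only [Realizes] at h h' <;> first | rfl | grind

lemma exists_realizes {c : Matrix (Fin 2) (Fin 2) ℝ} (hdet : c.det ≠ 0) (hd : charDisc c ≠ 0)
    (htr : c.trace ≠ 0) : ∃ L : LinearPortrait, L.Realizes c := by
  rcases hdet.lt_or_gt with h | h
  · exact ⟨.saddle, h⟩
  · rcases hd.lt_or_gt with h' | h'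
    · exact ⟨.focus, h', htr⟩
    · exact ⟨.node, h, h'⟩

/-! ### The index -/

lemma eq_norm_smul_of_polar {v : Plane} {r θ : ℝ} (hr : 0 ≤ r) (h0 : v 0 = r * Real.cos θ)
    (h1 : v 1 = r * Real.sin θ) : v = ‖v‖ • !₂[Real.cos θ, Real.sin θ] := by
  have hn : ‖v‖ = r := by
    rw [← sq_eq_sq₀ (norm_nonneg v) hr, norm_sq_plane, h0, h1]
    linear_combination r ^ 2 * Real.sin_sq_add_cos_sq θ
  rw [hn]
  exact plane_ext (by simpa using h0) (by simpa using h1)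

/-- The dominant term does all the winding. After factoring out α exp(ist), the cofactor is within
distance less than 1 of 1, so its principal argument is continuous and returns to its value after
one turn. -/
lemma exists_angle_of_norm_lt {α β : ℂ} (h : ‖β‖ < ‖α‖) (s : ℤ) :
    ∃ φ : ℝ → ℝ, Continuous φ ∧ φ (2 * Real.pi) = φ 0 + 2 * Real.pi * s ∧
      ∀ t : ℝ, ∃ r : ℝ, 0 ≤ r ∧
        α * Complex.exp ((s * t : ℝ) * Complex.I) + β * Complex.exp (-((s * t : ℝ) * Complex.I)) =
          r * Complex.exp (φ t * Complex.I) := by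
  have hα : 0 < ‖α‖ := (norm_nonneg β).trans_lt h
  have hα0 : α ≠ 0 := norm_pos_iff.1 hα
  let w : ℝ → ℂ := fun t => 1 + β / α * Complex.exp (((-2 * (s * t) : ℝ)) * Complex.I)
  have hw : ∀ t, w t ∈ Complex.slitPlane := by
    intro t
    refine Or.inl ?_
    have h1 : ‖β / α * Complex.exp (((-2 * (s * t) : ℝ)) * Complex.I)‖ < 1 := by
      rw [norm_mul, Complex.norm_exp_ofReal_mul_I, mul_one, norm_div]
      exact (div_lt_one hα).2 h
    have h2 := (abs_lt.1 ((Complex.abs_re_le_norm _).trans_lt h1)).1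
    simp only [w, Complex.add_re, Complex.one_re]
    linarith
  have hwc : Continuous w := by fun_prop
  refine ⟨fun t => Complex.arg α + s * t + Complex.arg (w t), ?_, ?_, fun t => ?_⟩
  · refine Continuous.add (by fun_prop) ?_
    exact continuous_iff_continuousAt.2 fun t =>
      (Complex.continuousAt_arg (hw t)).comp hwc.continuousAt
  · have h1 : w (2 * Real.pi) = w 0 := by
      have h2 : Complex.exp (((-2 * (s * (2 * Real.pi)) : ℝ)) * Complex.I) = 1 :=
        Complex.exp_eq_one_iff.2 ⟨-2 * s, by push_cast; ring⟩
      simp only [w, h2]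
      simp
    simp only [h1]
    ring
  · refine ⟨‖α‖ * ‖w t‖, by positivity, ?_⟩
    have e1 := Complex.norm_mul_exp_arg_mul_I α
    have e2 := Complex.norm_mul_exp_arg_mul_I (w t)
    have e3 : Complex.exp (-((s * t : ℝ) * Complex.I)) =
        Complex.exp ((s * t : ℝ) * Complex.I) *
          Complex.exp (((-2 * (s * t) : ℝ)) * Complex.I) := by
      rw [← Complex.exp_add]
      congr 1
      push_cast
      ring
    have e4 : Complex.exp ((Complex.arg α + s * t + Complex.arg (w t) : ℝ) * Complex.I) =
        Complex.exp (Complex.arg α * Complex.I) * Complex.exp ((s * t : ℝ) * Complex.I) *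
          Complex.exp (Complex.arg (w t) * Complex.I) := by
      rw [← Complex.exp_add, ← Complex.exp_add]
      congr 1
      push_cast
      ring
    have e5 : α * Complex.exp ((s * t : ℝ) * Complex.I) +
        β * Complex.exp (-((s * t : ℝ) * Complex.I)) =
          α * Complex.exp ((s * t : ℝ) * Complex.I) * w t := by
      rw [e3]
      simp only [w]
      field_simp
    rw [e4, e5]
    conv_lhs => rw [← e1, ← e2]
    push_cast
    ring

lemma hasIndex_of_complex {c : Matrix (Fin 2) (Fin 2) ℝ} (hc : c.det ≠ 0) {α β : ℂ} {s : ℤ}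
    (h : ‖β‖ < ‖α‖)
    (hf : ∀ t : ℝ, ((linearField c !₂[Real.cos t, Real.sin t] 0 : ℝ) : ℂ) +
      (linearField c !₂[Real.cos t, Real.sin t] 1 : ℝ) * Complex.I =
      α * Complex.exp ((s * t : ℝ) * Complex.I) +
        β * Complex.exp (-((s * t : ℝ) * Complex.I))) :
    HasIndex (linearField c) s := by
  obtain ⟨φ, hφ, hturn, hr⟩ := exists_angle_of_norm_lt h s
  refine ⟨1, one_pos, fun p _ => linearField_eq_zero_iff hc, φ, hφ, fun t => ?_, hturn⟩
  simp only [one_mul]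
  obtain ⟨r, hr0, h1⟩ := hr t
  rw [← hf t, Complex.exp_mul_I, ← Complex.ofReal_cos, ← Complex.ofReal_sin] at h1
  refine eq_norm_smul_of_polar hr0 ?_ ?_
  · simpa [Complex.cos_ofReal_re] using congrArg Complex.re h1
  · simpa [Complex.sin_ofReal_re] using congrArg Complex.im h1

/-- On the unit circle, in complex notation, the field is α exp(it) + β exp(-it) with |α|² - |β|² =
det, so the positively turning term dominates. -/
lemma hasIndex_of_det_pos {c : Matrix (Fin 2) (Fin 2) ℝ} (hc : 0 < c.det) :
    HasIndex (linearField c) 1 := by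
  rw [Matrix.det_fin_two] at hc
  refine hasIndex_of_complex (by rw [Matrix.det_fin_two]; exact hc.ne')
    (α := ⟨(c 0 0 + c 1 1) / 2, (c 1 0 - c 0 1) / 2⟩)
    (β := ⟨(c 0 0 - c 1 1) / 2, (c 1 0 + c 0 1) / 2⟩) ?_ fun t => ?_
  · rw [← sq_lt_sq₀ (norm_nonneg _) (norm_nonneg _), Complex.sq_norm, Complex.sq_norm,
      Complex.normSq_mk, Complex.normSq_mk]
    nlinarith
  · rw [← neg_mul, ← Complex.ofReal_neg, Complex.exp_mul_I, Complex.exp_mul_I,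
      ← Complex.ofReal_cos, ← Complex.ofReal_sin, ← Complex.ofReal_cos, ← Complex.ofReal_sin]
    refine Complex.ext ?_ ?_ <;> simp [linearField] <;> ring

/-- The same decomposition with the roles of α and β exchanged: now the negatively turning term
dominates. -/
lemma hasIndex_of_det_neg {c : Matrix (Fin 2) (Fin 2) ℝ} (hc : c.det < 0) :
    HasIndex (linearField c) (-1) := by
  rw [Matrix.det_fin_two] at hc
  refine hasIndex_of_complex (by rw [Matrix.det_fin_two]; exact hc.ne)
    (β := ⟨(c 0 0 + c 1 1) / 2, (c 1 0 - c 0 1) / 2⟩)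
    (α := ⟨(c 0 0 - c 1 1) / 2, (c 1 0 + c 0 1) / 2⟩) ?_ fun t => ?_
  · rw [← sq_lt_sq₀ (norm_nonneg _) (norm_nonneg _), Complex.sq_norm, Complex.sq_norm,
      Complex.normSq_mk, Complex.normSq_mk]
    nlinarith
  · rw [← neg_mul, ← Complex.ofReal_neg, Complex.exp_mul_I, Complex.exp_mul_I,
      ← Complex.ofReal_cos, ← Complex.ofReal_sin, ← Complex.ofReal_cos, ← Complex.ofReal_sin]
    refine Complex.ext ?_ ?_ <;> simp [linearField] <;> ring

lemma HasIndex.exists_angle {c : Matrix (Fin 2) (Fin 2) ℝ} {k : ℤ}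
    (h : HasIndex (linearField c) k) :
    ∃ φ : ℝ → ℝ, Continuous φ ∧ φ (2 * Real.pi) = φ 0 + 2 * Real.pi * k ∧
      ∀ t : ℝ, linearField c !₂[Real.cos t, Real.sin t] ≠ 0 ∧
        linearField c !₂[Real.cos t, Real.sin t] =
        ‖linearField c !₂[Real.cos t, Real.sin t]‖ • !₂[Real.cos (φ t), Real.sin (φ t)] := by
  obtain ⟨ε, hε, hz, φ, hφ, hf, hturn⟩ := h
  refine ⟨φ, hφ, hturn, fun t => ?_⟩
  have hv : ‖(!₂[Real.cos t, Real.sin t] : Plane)‖ = 1 :=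
    (norm_eq_one_iff_plane _).2 (by simp)
  have h1 : (!₂[ε * Real.cos t, ε * Real.sin t] : Plane) = ε • !₂[Real.cos t, Real.sin t] :=
    plane_ext (by simp) (by simp)
  have hft := hf t
  rw [h1, linearField_smul, norm_smul, Real.norm_of_nonneg hε.le, mul_smul] at hft
  refine ⟨fun h0 => ?_, smul_right_injective _ hε.ne' hft⟩
  have h2 := (hz (ε • !₂[Real.cos t, Real.sin t]) (by
    rw [norm_smul, hv, mul_one, Real.norm_of_nonneg hε.le])).1 (by
      rw [linearField_smul, h0, smul_zero])
  have h3 := (smul_eq_zero.1 h2).resolve_left hε.ne'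
  rw [h3, norm_zero] at hv
  exact zero_ne_one hv

/-- Two angle functions differ by a continuous function whose cosine is identically 1. If k ≠ k',
its end values differ by at least 2π, so it takes a value π away from the initial one, where the
cosine is -1. -/
lemma HasIndex.unique {c : Matrix (Fin 2) (Fin 2) ℝ} {k k' : ℤ}
    (h : HasIndex (linearField c) k) (h' : HasIndex (linearField c) k') : k = k' := by
  obtain ⟨φ, hφ, hturn, hf⟩ := h.exists_angle
  obtain ⟨ψ, hψ, hturn', hf'⟩ := h'.exists_angle
  have hcos : ∀ t, Real.cos (φ t - ψ t) = 1 := by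
    intro t
    have hne := norm_ne_zero_iff.2 (hf t).1
    have h1 := smul_right_injective Plane hne ((hf t).2.symm.trans (hf' t).2)
    have h2 : Real.cos (φ t) = Real.cos (ψ t) := by
      simpa using congrArg (fun v : Plane => v 0) h1
    have h3 : Real.sin (φ t) = Real.sin (ψ t) := by
      simpa using congrArg (fun v : Plane => v 1) h1
    rw [Real.cos_sub, h2, h3]
    linear_combination Real.sin_sq_add_cos_sq (ψ t)
  have hD : Continuous fun t => φ t - ψ t := hφ.sub hψ
  have hpi := Real.pi_pos
  have hivt := intermediate_value_uIcc (a := 0) (b := 2 * Real.pi) hD.continuousOn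
  have hend : φ (2 * Real.pi) - ψ (2 * Real.pi) = φ 0 - ψ 0 + 2 * Real.pi * (k - k') := by
    rw [hturn, hturn']
    ring
  simp only [hend] at hivt
  have h0 := hcos 0
  rcases lt_trichotomy k k' with hk | hk | hk
  · exfalso
    have hk' : (k : ℝ) - k' ≤ -1 := by
      have : k + 1 ≤ k' := hk
      have : (k : ℝ) + 1 ≤ k' := by exact_mod_cast this
      linarith
    have hmem : φ 0 - ψ 0 - Real.pi ∈
        Set.uIcc (φ 0 - ψ 0) (φ 0 - ψ 0 + 2 * Real.pi * (k - k')) :=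
      Set.mem_uIcc.2 (Or.inr ⟨by nlinarith, by linarith⟩)
    obtain ⟨t, -, ht⟩ := hivt hmem
    have h1 := hcos t
    simp only at ht
    rw [ht, Real.cos_sub_pi, h0] at h1
    norm_num at h1
  · exact hk
  · exfalso
    have hk' : 1 ≤ (k : ℝ) - k' := by
      have : k' + 1 ≤ k := hk
      have : (k' : ℝ) + 1 ≤ k := by exact_mod_cast this
      linarith
    have hmem : φ 0 - ψ 0 + Real.pi ∈
        Set.uIcc (φ 0 - ψ 0) (φ 0 - ψ 0 + 2 * Real.pi * (k - k')) :=
      Set.mem_uIcc.2 (Or.inl ⟨by linarith, by nlinarith⟩)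
    obtain ⟨t, -, ht⟩ := hivt hmem
    have h1 := hcos t
    simp only at ht
    rw [ht, Real.cos_add_pi, h0] at h1
    norm_num at h1

/-! ### Invariant lines -/

lemma exists_span_of_finrank_eq_one {L : Submodule ℝ Plane} (h : Module.finrank ℝ L = 1) :
    ∃ v : Plane, v ≠ 0 ∧ L = Submodule.span ℝ {v} := by
  obtain ⟨v, hv, hspan⟩ := finrank_eq_one_iff'.1 h
  refine ⟨v, fun h0 => hv (Subtype.ext h0), le_antisymm (fun w hw => ?_) ?_⟩
  · obtain ⟨r, hr⟩ := hspan ⟨w, hw⟩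
    exact Submodule.mem_span_singleton.2 ⟨r, congrArg Subtype.val hr⟩
  · rw [Submodule.span_singleton_le_iff_mem]
    exact v.2

lemma IsSolution.mem_of_forall_mem {c : Matrix (Fin 2) (Fin 2) ℝ} {η : ℝ → Plane}
    (hη : IsSolution (linearField c) η) {L : Submodule ℝ Plane} (h : ∀ t, η t ∈ L) :
    linearField c (η 0) ∈ L := by
  have h1 := hasDerivAt_iff_tendsto_slope.1 (hη 0)
  refine L.closed_of_finiteDimensional.mem_of_tendsto h1 (Eventually.of_forall fun t => ?_)
  rw [slope_def_module]
  exact L.smul_mem _ (L.sub_mem (h t) (h 0))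

/-- Invariant lines are eigenlines: the velocity of a curve in L lies in L, and conversely the
solution through an eigenvector is its multiple by an exponential. -/
lemma mem_invariantLines_iff {c : Matrix (Fin 2) (Fin 2) ℝ} {L : Submodule ℝ Plane} :
    L ∈ invariantLines (linearField c) ↔
      ∃ (v : Plane) (r : ℝ), v ≠ 0 ∧ linearField c v = r • v ∧ L = Submodule.span ℝ {v} := by
  constructor
  · rintro ⟨h1, h2⟩
    obtain ⟨v, hv, rfl⟩ := exists_span_of_finrank_eq_one h1
    obtain ⟨η, hη, h0⟩ := exists_isSolution_linearField c v
    have h3 := hη.mem_of_forall_mem (h2 η hη (by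
      rw [h0]
      exact Submodule.mem_span_singleton_self v))
    rw [h0] at h3
    obtain ⟨r, hr⟩ := Submodule.mem_span_singleton.1 h3
    exact ⟨v, r, hv, hr.symm, rfl⟩
  · rintro ⟨v, r, hv, hr, rfl⟩
    refine ⟨finrank_span_singleton hv, fun γ hγ h0 t => ?_⟩
    obtain ⟨s, hs⟩ := Submodule.mem_span_singleton.1 h0
    have hη : IsSolution (linearField c) fun t => (Real.exp (r * t) * s) • v := fun t => by
      have h1 : HasDerivAt (fun s : ℝ => r * s) r t := by
        simpa using (hasDerivAt_id t).const_mul r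
      refine ((h1.exp.mul_const s).smul_const v).congr_deriv ?_
      rw [linearField_smul, hr, smul_smul]
      congr 1
      ring
    rw [hγ.eq_of_eq hη (t₀ := 0) (by simp [hs])]
    exact Submodule.mem_span_singleton.2 ⟨_, rfl⟩

lemma invariantLines_of_conj_diag {c S T : Matrix (Fin 2) (Fin 2) ℝ} {a b : ℝ} (hab : a ≠ b)
    (hST : S * T = 1) (h : c * T = T * !![a, 0; 0, b]) :
    invariantLines (linearField c) = {Submodule.span ℝ {linearField T !₂[1, 0]},
      Submodule.span ℝ {linearField T !₂[0, 1]}} := by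
  have hTS : T * S = 1 := mul_eq_one_comm.1 hST
  have e0 : (!₂[1, 0] : Plane) ≠ 0 := fun h0 => by
    simpa using congrArg (fun v : Plane => v 0) h0
  have e1 : (!₂[0, 1] : Plane) ≠ 0 := fun h0 => by
    simpa using congrArg (fun v : Plane => v 1) h0
  have d0 : linearField !![a, 0; 0, b] !₂[1, 0] = a • !₂[1, 0] :=
    plane_ext (by simp [linearField]) (by simp [linearField])
  have d1 : linearField !![a, 0; 0, b] !₂[0, 1] = b • !₂[0, 1] :=
    plane_ext (by simp [linearField]) (by simp [linearField])
  ext L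
  rw [mem_invariantLines_iff, Set.mem_insert_iff, Set.mem_singleton_iff]
  constructor
  · rintro ⟨v, r, hv, hr, rfl⟩
    obtain ⟨w, rfl⟩ : ∃ w, v = linearField T w :=
      ⟨linearField S v, by rw [← linearField_mul, hTS, linearField_one]⟩
    rw [← linearField_mul, h, linearField_mul, ← linearField_smul] at hr
    have hinj : ∀ x y, linearField T x = linearField T y → x = y := fun x y hxy => by
      rw [← linearField_one x, ← hST, linearField_mul, hxy, ← linearField_mul, hST,
        linearField_one]
    have hw := hinj _ _ hr
    have h0 : a * w 0 = r * w 0 := by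
      simpa [linearField] using congrArg (fun v : Plane => v 0) hw
    have h1 : b * w 1 = r * w 1 := by
      simpa [linearField] using congrArg (fun v : Plane => v 1) hw
    have h2 : w 0 = 0 ∨ w 1 = 0 := by
      by_contra! hne
      exact hab ((mul_right_cancel₀ hne.1 h0).trans (mul_right_cancel₀ hne.2 h1).symm)
    rcases h2 with h2 | h2
    · right
      have hw1 : w = w 1 • !₂[0, 1] := plane_ext (by simp [h2]) (by simp)
      have hne : w 1 ≠ 0 := by
        intro h3
        rw [h3, zero_smul] at hw1
        exact hv (by rw [hw1, linearField_zero])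
      rw [hw1, linearField_smul]
      exact Submodule.span_singleton_smul_eq (isUnit_iff_ne_zero.2 hne) _
    · left
      have hw1 : w = w 0 • !₂[1, 0] := plane_ext (by simp) (by simp [h2])
      have hne : w 0 ≠ 0 := by
        intro h3
        rw [h3, zero_smul] at hw1
        exact hv (by rw [hw1, linearField_zero])
      rw [hw1, linearField_smul]
      exact Submodule.span_singleton_smul_eq (isUnit_iff_ne_zero.2 hne) _
  · rintro (rfl | rfl)
    · refine ⟨_, a, linearField_ne_zero hST e0, ?_, rfl⟩
      rw [← linearField_mul, h, linearField_mul, d0, linearField_smul]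
    · refine ⟨_, b, linearField_ne_zero hST e1, ?_, rfl⟩
      rw [← linearField_mul, h, linearField_mul, d1, linearField_smul]

lemma encard_invariantLines_of_charDisc_pos {c : Matrix (Fin 2) (Fin 2) ℝ}
    (h : 0 < charDisc c) : (invariantLines (linearField c)).encard = (2 : ℕ) := by
  obtain ⟨a, b, hab, htr, hdet⟩ := exists_roots h
  obtain ⟨S, T, hST, hT⟩ := exists_conj_diag hab.ne' htr hdet
  rw [invariantLines_of_conj_diag hab.ne' hST hT, Set.encard_pair]
  · rfl
  · intro heq
    have h1 : linearField T !₂[1, 0] ∈ Submodule.span ℝ {linearField T !₂[0, 1]} :=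
      heq ▸ Submodule.mem_span_singleton_self _
    obtain ⟨r, hr⟩ := Submodule.mem_span_singleton.1 h1
    have h2 : (r • !₂[0, 1] : Plane) = !₂[1, 0] := by
      rw [← linearField_one (r • _), ← hST, linearField_mul, linearField_smul, hr,
        ← linearField_mul, hST, linearField_one]
    simpa using congrArg (fun v : Plane => v 0) h2

lemma encard_invariantLines_of_charDisc_neg {c : Matrix (Fin 2) (Fin 2) ℝ}
    (h : charDisc c < 0) : (invariantLines (linearField c)).encard = (0 : ℕ) := by
  rw [Nat.cast_zero, Set.encard_eq_zero, Set.eq_empty_iff_forall_notMem]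
  intro L hL
  obtain ⟨v, r, hv, hr, -⟩ := mem_invariantLines_iff.1 hL
  refine not_hasZeroAtInfinity_of_charDisc_neg h ⟨diskPoint v 0, ?_, ?_⟩
  · exact (norm_compactify_eq_one_iff (Or.inl hv)).2 rfl
  · change poincareField (linearField c) (compactify v 0) = 0
    rw [poincareField_eq_zero_iff_cross ((norm_compactify_eq_one_iff (Or.inl hv)).2 rfl)]
    rw [compactify, linearField_smul, hr]
    simp
    ring

/-- The couple (index, number of invariant lines) of each portrait. -/
def LinearPortrait.couple : LinearPortrait → ℤ × ℕ
  | .saddle => (-1, 2)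
  | .node => (1, 2)
  | .focus => (1, 0)

lemma LinearPortrait.couple_injective : Function.Injective LinearPortrait.couple := by
  intro L L' h
  cases L <;> cases L' <;> simp_all [couple]

lemma LinearPortrait.Realizes.hasCouple {L : LinearPortrait} {c : Matrix (Fin 2) (Fin 2) ℝ}
    (h : L.Realizes c) : HasCouple (linearField c) L.couple.1 L.couple.2 := by
  cases L with
  | saddle =>
    refine ⟨hasIndex_of_det_neg h, encard_invariantLines_of_charDisc_pos ?_⟩
    have h1 : c.det < 0 := h
    rw [charDisc_eq]
    nlinarith [sq_nonneg c.trace]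
  | node => exact ⟨hasIndex_of_det_pos h.1, encard_invariantLines_of_charDisc_pos h.2⟩
  | focus =>
    refine ⟨hasIndex_of_det_pos ?_, encard_invariantLines_of_charDisc_neg h.1⟩
    have h1 := h.1
    rw [charDisc_eq] at h1
    nlinarith [sq_nonneg c.trace]

lemma HasCouple.unique {c : Matrix (Fin 2) (Fin 2) ℝ} {i i' : ℤ} {l l' : ℕ}
    (h : HasCouple (linearField c) i l) (h' : HasCouple (linearField c) i' l') :
    (i, l) = (i', l') :=
  Prod.ext (h.1.unique h'.1) (Nat.cast_injective (h.2.symm.trans h'.2))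

lemma LinearPortrait.Realizes.hasCouple_iff {L : LinearPortrait}
    {c : Matrix (Fin 2) (Fin 2) ℝ} (h : L.Realizes c) {i : ℤ} {l : ℕ} :
    HasCouple (linearField c) i l ↔ (i, l) = L.couple :=
  ⟨fun h' => h'.unique h.hasCouple, fun h' => by
    obtain ⟨rfl, rfl⟩ := Prod.ext_iff.1 h'
    exact h.hasCouple⟩

lemma LinearPortrait.Realizes.hasPortrait_iff_hasCouple {L : LinearPortrait}
    {c : Matrix (Fin 2) (Fin 2) ℝ} (h : L.Realizes c) (L' : LinearPortrait) :
    HasPortrait (linearField c) L' ↔ HasCouple (linearField c) L'.couple.1 L'.couple.2 := by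
  rw [hasPortrait_iff, h.hasCouple_iff]
  constructor
  · intro h'
    rw [h.unique h']
  · intro h'
    rwa [LinearPortrait.couple_injective h']

lemma LinearPortrait.Realizes.samePortrait_iff {L L' : LinearPortrait}
    {c c' : Matrix (Fin 2) (Fin 2) ℝ} (h : L.Realizes c) (h' : L'.Realizes c') :
    SamePortrait (linearField c) (linearField c') ↔
      ∃ (i : ℤ) (l : ℕ), HasCouple (linearField c) i l ∧ HasCouple (linearField c') i l := by
  simp_rw [h.hasCouple_iff, h'.hasCouple_iff]
  constructor
  · intro hs
    obtain rfl := h.unique (h'.of_samePortrait hs)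
    exact ⟨_, _, rfl, rfl⟩
  · rintro ⟨i, l, h1, h2⟩
    obtain rfl := LinearPortrait.couple_injective (h1.symm.trans h2)
    exact h.hasPortrait.trans h'.hasPortrait.symm

/-! ### Gaussian measures of quadratic cones -/

lemma gaussianReal_prod_gaussianReal :
    (gaussianReal 0 1).prod (gaussianReal 0 1) = (volume : Measure (ℝ × ℝ)).withDensity
      fun p => ENNReal.ofReal ((2 * Real.pi)⁻¹ * Real.exp (-(p.1 ^ 2 + p.2 ^ 2) / 2)) := by
  rw [gaussianReal_of_var_ne_zero 0 one_ne_zero,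
    prod_withDensity (measurable_gaussianPDF 0 1) (measurable_gaussianPDF 0 1)]
  refine congrArg₂ _ rfl (funext fun p => ?_)
  simp only [gaussianPDF_def]
  rw [← ENNReal.ofReal_mul (gaussianPDFReal_nonneg _ _ _)]
  congr 1
  simp only [gaussianPDFReal, sub_zero, NNReal.coe_one, mul_one]
  have h1 : (√(2 * Real.pi))⁻¹ * (√(2 * Real.pi))⁻¹ = (2 * Real.pi)⁻¹ := by
    rw [← mul_inv, Real.mul_self_sqrt (by positivity)]
  have h2 : Real.exp (-(p.1 ^ 2 + p.2 ^ 2) / 2) =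
      Real.exp (-p.1 ^ 2 / 2) * Real.exp (-p.2 ^ 2 / 2) := by
    rw [← Real.exp_add]
    congr 1
    ring
  rw [← h1, h2]
  ring

lemma lintegral_Ioi_mul_exp_neg_sq {a : ℝ} (ha : 0 ≤ a) :
    ∫⁻ r in Set.Ioi a, ENNReal.ofReal (r * Real.exp (-r ^ 2 / 2)) =
      ENNReal.ofReal (Real.exp (-a ^ 2 / 2)) := by
  have hderiv : ∀ x ∈ Set.Ici a, HasDerivAt (fun r : ℝ => -Real.exp (-r ^ 2 / 2))
      (x * Real.exp (-x ^ 2 / 2)) x := by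
    intro x _
    have h1 : HasDerivAt (fun r : ℝ => -r ^ 2 / 2) (-x) x := by
      refine ((hasDerivAt_pow 2 x).neg.div_const 2).congr_deriv ?_
      simp
      ring
    exact h1.exp.neg.congr_deriv (by ring)
  have hpos : ∀ x ∈ Set.Ioi a, 0 ≤ x * Real.exp (-x ^ 2 / 2) := fun x hx =>
    mul_nonneg (ha.trans (le_of_lt hx)) (Real.exp_pos _).le
  have hlim : Tendsto (fun r : ℝ => -Real.exp (-r ^ 2 / 2)) atTop (𝓝 (-0)) := by
    refine (Real.tendsto_exp_comp_nhds_zero.2 ?_).neg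
    refine Tendsto.atBot_div_const two_pos ?_
    exact tendsto_neg_atTop_atBot.comp (tendsto_pow_atTop two_ne_zero)
  rw [← ofReal_integral_eq_lintegral_ofReal
    (integrableOn_Ioi_deriv_of_nonneg' hderiv hpos hlim)
    ((ae_restrict_iff' measurableSet_Ioi).2 (ae_of_all _ hpos)),
    integral_Ioi_of_hasDerivAt_of_nonneg' hderiv hpos hlim]
  simp

/-- In polar coordinates the density depends on the radius only, the angle contributes 2π, and r
exp(-r²/2) has the primitive -exp(-r²/2). -/
lemma gaussian_prod_radius_tail {s : ℝ} (hs : 0 ≤ s) :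
    ((gaussianReal 0 1).prod (gaussianReal 0 1)) {p : ℝ × ℝ | s < p.1 ^ 2 + p.2 ^ 2} =
      ENNReal.ofReal (Real.exp (-s / 2)) := by
  have hS : MeasurableSet {p : ℝ × ℝ | s < p.1 ^ 2 + p.2 ^ 2} :=
    measurableSet_lt measurable_const (by fun_prop)
  rw [gaussianReal_prod_gaussianReal, withDensity_apply _ hS, ← lintegral_indicator hS,
    ← lintegral_comp_polarCoord_symm]
  have hpi := Real.pi_pos
  set G : ℝ → ENNReal := fun r => (Set.Ioi (√s)).indicator
    (fun r => ENNReal.ofReal ((2 * Real.pi)⁻¹) * ENNReal.ofReal (r * Real.exp (-r ^ 2 / 2))) r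
    with hG
  have hGm : Measurable G := Measurable.indicator (by fun_prop) measurableSet_Ioi
  have h1 : ∀ p ∈ polarCoord.target, ENNReal.ofReal p.1 •
      ({p : ℝ × ℝ | s < p.1 ^ 2 + p.2 ^ 2}.indicator (fun p => ENNReal.ofReal
        ((2 * Real.pi)⁻¹ * Real.exp (-(p.1 ^ 2 + p.2 ^ 2) / 2))) (polarCoord.symm p)) =
      G p.1 := by
    rintro ⟨r, θ⟩ ⟨hr, -⟩
    have hr : 0 < r := hr
    have h2 : (r * Real.cos θ) ^ 2 + (r * Real.sin θ) ^ 2 = r ^ 2 := by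
      linear_combination r ^ 2 * Real.sin_sq_add_cos_sq θ
    simp only [hG, polarCoord_symm_apply, Set.indicator_apply, Set.mem_ofPred_eq, h2,
      Set.mem_Ioi, Real.sqrt_lt' hr]
    split_ifs
    · rw [smul_eq_mul, ← ENNReal.ofReal_mul hr.le, ← ENNReal.ofReal_mul (by positivity)]
      congr 1
      ring
    · simp
  rw [setLIntegral_congr_fun polarCoord.open_target.measurableSet h1, polarCoord_target,
    Measure.volume_eq_prod, ← Measure.prod_restrict,
    lintegral_prod (fun p : ℝ × ℝ => G p.1) (hGm.comp measurable_fst).aemeasurable]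
  simp only [lintegral_const, Measure.restrict_apply_univ, Real.volume_Ioo]
  rw [lintegral_mul_const _ hGm]
  have h3 : ∫⁻ r in Set.Ioi 0, G r = ENNReal.ofReal ((2 * Real.pi)⁻¹) *
      ENNReal.ofReal (Real.exp (-s / 2)) := by
    rw [hG, lintegral_indicator measurableSet_Ioi, Measure.restrict_restrict measurableSet_Ioi,
      Set.inter_eq_left.2 (Set.Ioi_subset_Ioi (Real.sqrt_nonneg s)),
      lintegral_const_mul _ (by fun_prop), lintegral_Ioi_mul_exp_neg_sq (Real.sqrt_nonneg s),
      Real.sq_sqrt hs]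
  rw [h3, ← ENNReal.ofReal_mul (by positivity), ← ENNReal.ofReal_mul (by positivity)]
  congr 1
  field_simp
  ring

lemma lintegral_exp_neg_sq_gaussianReal :
    ∫⁻ w, ENNReal.ofReal (Real.exp (-w ^ 2 / 2)) ∂(gaussianReal 0 1) =
      ENNReal.ofReal (√2 / 2) := by
  have h1 : ∫ w, Real.exp (-w ^ 2 / 2) ∂(gaussianReal 0 1) = √2 / 2 := by
    rw [integral_gaussianReal_eq_integral_smul one_ne_zero]
    have h2 : ∀ w : ℝ, gaussianPDFReal 0 1 w • Real.exp (-w ^ 2 / 2) =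
        (√(2 * Real.pi))⁻¹ * Real.exp (-1 * w ^ 2) := fun w => by
      simp only [gaussianPDFReal, sub_zero, NNReal.coe_one, mul_one, smul_eq_mul]
      rw [mul_assoc, ← Real.exp_add]
      congr 2
      ring
    simp_rw [h2]
    rw [integral_const_mul, integral_gaussian, div_one, Real.sqrt_mul (by norm_num)]
    have h3 : √Real.pi ≠ 0 := (Real.sqrt_pos.2 Real.pi_pos).ne'
    have h4 : √2 ≠ 0 := by positivity
    have h5 : √2 * √2 = 2 := Real.mul_self_sqrt (by norm_num)
    field_simp
    linarith
  rw [← h1, ofReal_integral_eq_lintegral_ofReal ?_ (ae_of_all _ fun w => (Real.exp_pos _).le)]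
  refine Integrable.of_bound (C := 1) (by fun_prop) (ae_of_all _ fun w => ?_)
  rw [Real.norm_of_nonneg (Real.exp_pos _).le, Real.exp_le_one_iff]
  nlinarith [sq_nonneg w]

/-- Conditioning on the third coordinate w turns the cone into the exterior of a disk of radius |w|,
so the probability is the mean of exp(-w²/2). -/
lemma gaussian_cone :
    (((gaussianReal 0 1).prod (gaussianReal 0 1)).prod (gaussianReal 0 1))
      {p : (ℝ × ℝ) × ℝ | p.2 ^ 2 < p.1.1 ^ 2 + p.1.2 ^ 2} = ENNReal.ofReal (√2 / 2) := by
  have hS : MeasurableSet {p : (ℝ × ℝ) × ℝ | p.2 ^ 2 < p.1.1 ^ 2 + p.1.2 ^ 2} :=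
    measurableSet_lt (by fun_prop) (by fun_prop)
  rw [Measure.prod_apply_symm hS, ← lintegral_exp_neg_sq_gaussianReal]
  exact lintegral_congr fun w => gaussian_prod_radius_tail (sq_nonneg w)

lemma gaussian_cone_boundary :
    (((gaussianReal 0 1).prod (gaussianReal 0 1)).prod (gaussianReal 0 1))
      {p : (ℝ × ℝ) × ℝ | p.2 ^ 2 = p.1.1 ^ 2 + p.1.2 ^ 2} = 0 := by
  have := nullSingletonClass_gaussianReal (μ := 0) one_ne_zero
  refine (Measure.measure_prod_null (measurableSet_eq_fun (by fun_prop) (by fun_prop))).2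
    (ae_of_all _ fun p => ?_)
  refine Set.Finite.measure_zero (Set.Finite.subset
    (s := {√(p.1 ^ 2 + p.2 ^ 2), -√(p.1 ^ 2 + p.2 ^ 2)}) (by simp) fun w hw => ?_) _
  have hw : w ^ 2 = p.1 ^ 2 + p.2 ^ 2 := hw
  rw [← Real.sq_sqrt (by positivity : 0 ≤ p.1 ^ 2 + p.2 ^ 2)] at hw
  exact sq_eq_sq_iff_eq_or_eq_neg.1 hw

/-- With the first three coordinates fixed and the third nonzero, the equation determines the
fourth, and points have measure zero. -/
lemma gaussian_quadric :
    (((gaussianReal 0 1).prod (gaussianReal 0 1)).prod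
      ((gaussianReal 0 1).prod (gaussianReal 0 1)))
      {p : (ℝ × ℝ) × (ℝ × ℝ) | p.1.1 * p.1.2 = p.2.1 * p.2.2} = 0 := by
  have := nullSingletonClass_gaussianReal (μ := 0) one_ne_zero
  refine (Measure.measure_prod_null (measurableSet_eq_fun (by fun_prop) (by fun_prop))).2
    (ae_of_all _ fun p => ?_)
  refine (Measure.measure_prod_null (measurableSet_eq_fun (by fun_prop) (by fun_prop))).2 ?_
  have h0 : ∀ᵐ b ∂(gaussianReal 0 1), b ≠ 0 := by
    rw [ae_iff]
    simp
  filter_upwards [h0] with b hb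
  refine Set.Subsingleton.measure_zero (fun x hx y hy => ?_) _
  have hx : p.1 * p.2 = b * x := hx
  have hy : p.1 * p.2 = b * y := hy
  exact mul_left_cancel₀ hb (hx.symm.trans hy)

/-! ### Random Gaussian matrices -/

/-- The space of `2 × 2` matrices, as a Euclidean space. -/
abbrev MatrixSpace : Type := EuclideanSpace ℝ (Fin 2 × Fin 2)

/-- The matrix with given entries. -/
def toMatrix (x : MatrixSpace) : Matrix (Fin 2) (Fin 2) ℝ := Matrix.of fun i j => x (i, j)

lemma map_eval_stdGaussian (p : Fin 2 × Fin 2) :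
    (stdGaussian MatrixSpace).map (fun x => x p) = gaussianReal 0 1 := by
  rw [← map_pi_eq_stdGaussian, Measure.map_map (by fun_prop) (by fun_prop)]
  exact (measurePreserving_eval (fun _ : Fin 2 × Fin 2 => gaussianReal 0 1) p).map_eq

lemma iIndepFun_eval_stdGaussian :
    iIndepFun (fun (p : Fin 2 × Fin 2) (x : MatrixSpace) => x p) (stdGaussian MatrixSpace) := by
  rw [iIndepFun_iff_map_fun_eq_pi_map (fun p => by fun_prop)]
  simp_rw [map_eval_stdGaussian]
  rw [← map_pi_eq_stdGaussian, Measure.map_map (by fun_prop) (by fun_prop)]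
  exact Measure.map_id

lemma map_pair_stdGaussian {p q : Fin 2 × Fin 2} (h : p ≠ q) :
    (stdGaussian MatrixSpace).map (fun x => (x p, x q)) =
      (gaussianReal 0 1).prod (gaussianReal 0 1) := by
  rw [(indepFun_iff_map_prod_eq_prod_map_map (by fun_prop) (by fun_prop)).1
    (iIndepFun_eval_stdGaussian.indepFun h), map_eval_stdGaussian, map_eval_stdGaussian]

lemma map_triple_stdGaussian {p q r : Fin 2 × Fin 2} (hpq : p ≠ q) (hpr : p ≠ r) (hqr : q ≠ r) :
    (stdGaussian MatrixSpace).map (fun x => ((x p, x q), x r)) =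
      ((gaussianReal 0 1).prod (gaussianReal 0 1)).prod (gaussianReal 0 1) := by
  rw [(indepFun_iff_map_prod_eq_prod_map_map (by fun_prop) (by fun_prop)).1
    (iIndepFun_eval_stdGaussian.indepFun_prodMk (by fun_prop) p q r hpr hqr),
    map_eval_stdGaussian, map_pair_stdGaussian hpq]

lemma map_quadruple_stdGaussian {p q r s : Fin 2 × Fin 2} (hpq : p ≠ q) (hrs : r ≠ s)
    (hpr : p ≠ r) (hps : p ≠ s) (hqr : q ≠ r) (hqs : q ≠ s) :
    (stdGaussian MatrixSpace).map (fun x => ((x p, x q), (x r, x s))) =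
      ((gaussianReal 0 1).prod (gaussianReal 0 1)).prod
        ((gaussianReal 0 1).prod (gaussianReal 0 1)) := by
  rw [(indepFun_iff_map_prod_eq_prod_map_map (by fun_prop) (by fun_prop)).1
    (iIndepFun_eval_stdGaussian.indepFun_prodMk_prodMk (by fun_prop) p q r s hpr hps hqr hqs),
    map_pair_stdGaussian hpq, map_pair_stdGaussian hrs]

lemma stdGaussian_preimage (e : MatrixSpace ≃ₗᵢ[ℝ] MatrixSpace) {s : Set MatrixSpace}
    (hs : MeasurableSet s) :
    stdGaussian MatrixSpace (e ⁻¹' s) = stdGaussian MatrixSpace s := by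
  have h := stdGaussian_map e
  conv_rhs => rw [← h]
  rw [Measure.map_apply e.continuous.measurable hs]

/-- The coordinates `((A + D) / √2, (B + C) / √2, (B - C) / √2, (A - D) / √2)`. -/
noncomputable def halfTurnFun (x : MatrixSpace) : MatrixSpace :=
  WithLp.toLp 2 fun p => (√2)⁻¹ * !![x (0, 0) + x (1, 1), x (0, 1) + x (1, 0);
    x (0, 1) - x (1, 0), x (0, 0) - x (1, 1)] p.1 p.2

lemma halfTurnFun_apply (x : MatrixSpace) (p : Fin 2 × Fin 2) :
    halfTurnFun x p = (√2)⁻¹ * !![x (0, 0) + x (1, 1), x (0, 1) + x (1, 0);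
      x (0, 1) - x (1, 0), x (0, 0) - x (1, 1)] p.1 p.2 := rfl

lemma inv_sqrt_two_mul_self : (√2)⁻¹ * (√2)⁻¹ = (2 : ℝ)⁻¹ := by
  rw [← mul_inv, Real.mul_self_sqrt (by norm_num)]

/-- An isometric involution of the space of matrices that diagonalises the trace, the determinant
and the discriminant. -/
noncomputable def halfTurn : MatrixSpace ≃ₗᵢ[ℝ] MatrixSpace where
  toLinearEquiv := LinearEquiv.ofInvolutive
    { toFun := halfTurnFun
      map_add' := fun x y => by
        ext ⟨i, j⟩
        fin_cases i <;> fin_cases j <;> simp [halfTurnFun_apply] <;> ring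
      map_smul' := fun r x => by
        ext ⟨i, j⟩
        fin_cases i <;> fin_cases j <;> simp [halfTurnFun_apply] <;> ring }
    (fun x => by
      have h := inv_sqrt_two_mul_self
      ext ⟨i, j⟩
      fin_cases i <;> fin_cases j <;> simp [halfTurnFun_apply]
      · linear_combination 2 * x (0, 0) * h
      · linear_combination 2 * x (0, 1) * h
      · linear_combination 2 * x (1, 0) * h
      · linear_combination 2 * x (1, 1) * h)
  norm_map' := fun x => by
    have h := inv_sqrt_two_mul_self
    change ‖halfTurnFun x‖ = ‖x‖
    rw [← sq_eq_sq₀ (norm_nonneg _) (norm_nonneg _), EuclideanSpace.real_norm_sq_eq,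
      EuclideanSpace.real_norm_sq_eq]
    simp only [Fintype.sum_prod_type, Fin.sum_univ_two, halfTurnFun_apply, Matrix.of_apply,
      Matrix.cons_val]
    linear_combination 2 * (x (0, 0) ^ 2 + x (0, 1) ^ 2 + x (1, 0) ^ 2 + x (1, 1) ^ 2) * h

lemma halfTurn_apply (x : MatrixSpace) : halfTurn x = halfTurnFun x := rfl

lemma charDisc_toMatrix (x : MatrixSpace) : charDisc (toMatrix x) =
    2 * ((halfTurn x (0, 1)) ^ 2 + (halfTurn x (1, 1)) ^ 2 - (halfTurn x (1, 0)) ^ 2) := by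
  have h := inv_sqrt_two_mul_self
  simp only [halfTurn_apply, halfTurnFun_apply, charDisc, toMatrix, Matrix.of_apply,
    Matrix.cons_val]
  linear_combination -2 * ((x (0, 0) - x (1, 1)) ^ 2 + 4 * (x (0, 1) * x (1, 0))) * h

lemma trace_toMatrix (x : MatrixSpace) : (toMatrix x).trace = √2 * halfTurn x (0, 0) := by
  have h : √2 * (√2)⁻¹ = 1 := mul_inv_cancel₀ (by positivity)
  rw [Matrix.trace_fin_two]
  simp only [halfTurn_apply, halfTurnFun_apply, toMatrix, Matrix.of_apply, Matrix.cons_val]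
  linear_combination -(x (0, 0) + x (1, 1)) * h

lemma det_toMatrix (x : MatrixSpace) :
    (toMatrix x).det = x (0, 0) * x (1, 1) - x (0, 1) * x (1, 0) := by
  rw [Matrix.det_fin_two]
  rfl

/-! ### Null sets and probabilities of the regions of matrices. -/

lemma measurable_charDisc_toMatrix : Measurable fun x : MatrixSpace => charDisc (toMatrix x) := by
  simp only [charDisc, toMatrix, Matrix.of_apply]
  fun_prop

lemma measurable_trace_toMatrix : Measurable fun x : MatrixSpace => (toMatrix x).trace := by
  simp only [Matrix.trace_fin_two, toMatrix, Matrix.of_apply]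
  fun_prop

lemma measurable_det_toMatrix : Measurable fun x : MatrixSpace => (toMatrix x).det := by
  simp only [det_toMatrix]
  fun_prop

lemma stdGaussian_charDisc_pos :
    stdGaussian MatrixSpace {x | 0 < charDisc (toMatrix x)} = ENNReal.ofReal (√2 / 2) := by
  have h1 : {x : MatrixSpace | 0 < charDisc (toMatrix x)} =
      halfTurn ⁻¹' {y | y (1, 0) ^ 2 < y (0, 1) ^ 2 + y (1, 1) ^ 2} := by
    ext x
    simp only [charDisc_toMatrix, Set.mem_ofPred_eq, Set.mem_preimage]
    constructor <;> intro h <;> linarith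
  rw [h1, stdGaussian_preimage _ (measurableSet_lt (by fun_prop) (by fun_prop)), ← gaussian_cone,
    ← map_triple_stdGaussian (p := (0, 1)) (q := (1, 1)) (r := (1, 0)) (by decide) (by decide)
      (by decide),
    Measure.map_apply (by fun_prop) (measurableSet_lt (by fun_prop) (by fun_prop))]
  rfl

lemma ae_charDisc_ne_zero : ∀ᵐ x ∂(stdGaussian MatrixSpace), charDisc (toMatrix x) ≠ 0 := by
  rw [ae_iff]
  have h1 : {x : MatrixSpace | ¬charDisc (toMatrix x) ≠ 0} =
      halfTurn ⁻¹' {y | y (1, 0) ^ 2 = y (0, 1) ^ 2 + y (1, 1) ^ 2} := by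
    ext x
    simp only [charDisc_toMatrix, Set.mem_ofPred_eq, Set.mem_preimage, not_not]
    constructor <;> intro h <;> linarith
  rw [h1, stdGaussian_preimage _ (measurableSet_eq_fun (by fun_prop) (by fun_prop)),
    ← gaussian_cone_boundary,
    ← map_triple_stdGaussian (p := (0, 1)) (q := (1, 1)) (r := (1, 0)) (by decide) (by decide)
      (by decide),
    Measure.map_apply (by fun_prop) (measurableSet_eq_fun (by fun_prop) (by fun_prop))]
  rfl

lemma ae_trace_ne_zero : ∀ᵐ x ∂(stdGaussian MatrixSpace), (toMatrix x).trace ≠ 0 := by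
  have := nullSingletonClass_gaussianReal (μ := 0) one_ne_zero
  rw [ae_iff]
  have h1 : {x : MatrixSpace | ¬(toMatrix x).trace ≠ 0} =
      halfTurn ⁻¹' ((fun y => y (0, 0)) ⁻¹' {0}) := by
    ext x
    simp [trace_toMatrix]
  rw [h1, stdGaussian_preimage _ (measurableSet_preimage (by fun_prop) (by simp)),
    ← Measure.map_apply (by fun_prop) (by simp), map_eval_stdGaussian]
  exact measure_singleton 0

lemma ae_det_ne_zero : ∀ᵐ x ∂(stdGaussian MatrixSpace), (toMatrix x).det ≠ 0 := by
  rw [ae_iff]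
  have h := gaussian_quadric
  rw [← map_quadruple_stdGaussian (p := (0, 0)) (q := (1, 1)) (r := (0, 1)) (s := (1, 0))
      (by decide) (by decide) (by decide) (by decide) (by decide) (by decide),
    Measure.map_apply (by fun_prop) (measurableSet_eq_fun (by fun_prop) (by fun_prop))] at h
  rw [← h]
  congr 1
  ext x
  simp [det_toMatrix, sub_eq_zero]

lemma measureReal_eq_add_of_ae {α : Type*} [MeasurableSpace α] {μ : Measure α}
    [IsFiniteMeasure μ] {p q r : α → Prop} (hq : MeasurableSet {x | q x})
    (h : ∀ᵐ x ∂μ, r x ↔ p x ∨ q x) (hd : ∀ x, p x → ¬q x) :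
    μ.real {x | r x} = μ.real {x | p x} + μ.real {x | q x} := by
  have h1 : {x | r x} =ᵐ[μ] ({x | p x} ∪ {x | q x} : Set α) := by
    filter_upwards [h] with x hx
    exact propext hx
  have h2 : Disjoint {x | p x} {x | q x} := Set.disjoint_left.2 hd
  rw [measureReal_congr h1, measureReal_union h2 hq]

/-- The exchange of the rows. -/
noncomputable def rowSwap : MatrixSpace ≃ₗᵢ[ℝ] MatrixSpace :=
  LinearIsometryEquiv.piLpCongrLeft 2 ℝ ℝ ((Equiv.swap (0 : Fin 2) 1).prodCongr (Equiv.refl _))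

lemma det_rowSwap (x : MatrixSpace) : (toMatrix (rowSwap x)).det = -(toMatrix x).det := by
  have h : ∀ i j, rowSwap x (i, j) = x (Equiv.swap 0 1 i, j) := fun i j => rfl
  rw [det_toMatrix, det_toMatrix, h, h, h, h]
  simp
  ring

lemma real_det_pos_eq_neg : (stdGaussian MatrixSpace).real {x | 0 < (toMatrix x).det} =
    (stdGaussian MatrixSpace).real {x | (toMatrix x).det < 0} := by
  have h1 : {x | (toMatrix x).det < 0} = rowSwap ⁻¹' {x | 0 < (toMatrix x).det} := by
    ext x
    simp [det_rowSwap]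
  rw [measureReal_def, measureReal_def, h1, stdGaussian_preimage _
    (measurableSet_lt measurable_const measurable_det_toMatrix)]

/-- Exchanging the rows makes the two signs equally likely, and det = 0 is a null event. -/
lemma real_det_neg : (stdGaussian MatrixSpace).real {x | (toMatrix x).det < 0} = 1 / 2 := by
  have h := measureReal_eq_add_of_ae (μ := stdGaussian MatrixSpace) (r := fun _ => True)
    (p := fun x => (toMatrix x).det < 0) (q := fun x => 0 < (toMatrix x).det)
    (measurableSet_lt measurable_const measurable_det_toMatrix)
    (ae_det_ne_zero.mono fun x hx => by simpa using hx) (fun x h => not_lt.2 h.le)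
  rw [real_det_pos_eq_neg, Set.ofPred_true, probReal_univ] at h
  linarith

lemma real_det_pos : (stdGaussian MatrixSpace).real {x | 0 < (toMatrix x).det} = 1 / 2 := by
  rw [real_det_pos_eq_neg, real_det_neg]

lemma real_charDisc_pos :
    (stdGaussian MatrixSpace).real {x | 0 < charDisc (toMatrix x)} = √2 / 2 := by
  rw [measureReal_def, stdGaussian_charDisc_pos, ENNReal.toReal_ofReal (by positivity)]

lemma charDisc_pos_of_det_neg {c : Matrix (Fin 2) (Fin 2) ℝ} (h : c.det < 0) :
    0 < charDisc c := by
  rw [charDisc_eq]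
  nlinarith [sq_nonneg c.trace]

/-- Up to a null set, {disc > 0} is the disjoint union of {det < 0}, on which disc > 0 is automatic,
and the node region. -/
lemma real_node : (stdGaussian MatrixSpace).real
    {x | 0 < (toMatrix x).det ∧ 0 < charDisc (toMatrix x)} = √2 / 2 - 1 / 2 := by
  have h := measureReal_eq_add_of_ae (μ := stdGaussian MatrixSpace)
    (r := fun x => 0 < charDisc (toMatrix x)) (p := fun x => (toMatrix x).det < 0)
    (q := fun x => 0 < (toMatrix x).det ∧ 0 < charDisc (toMatrix x))
    ((measurableSet_lt measurable_const measurable_det_toMatrix).inter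
      (measurableSet_lt measurable_const measurable_charDisc_toMatrix))
    (ae_det_ne_zero.mono fun x hx => ⟨fun h => hx.lt_or_gt.imp_right fun h' => ⟨h', h⟩,
      fun h => h.elim charDisc_pos_of_det_neg And.right⟩)
    (fun x h h' => lt_asymm h h'.1)
  rw [real_charDisc_pos, real_det_neg] at h
  linarith

lemma real_focus : (stdGaussian MatrixSpace).real
    {x | charDisc (toMatrix x) < 0 ∧ (toMatrix x).trace ≠ 0} = 1 - √2 / 2 := by
  have h := measureReal_eq_add_of_ae (μ := stdGaussian MatrixSpace)
    (r := fun _ => True) (p := fun x => 0 < charDisc (toMatrix x))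
    (q := fun x => charDisc (toMatrix x) < 0 ∧ (toMatrix x).trace ≠ 0)
    ((measurableSet_lt measurable_charDisc_toMatrix measurable_const).inter
      (measurable_trace_toMatrix (measurableSet_singleton 0).compl))
    (by
      filter_upwards [ae_charDisc_ne_zero, ae_trace_ne_zero] with x hx hx'
      exact ⟨fun _ => hx.symm.lt_or_gt.imp_right fun h' => ⟨h', hx'⟩, fun _ => trivial⟩)
    (fun x h h' => lt_asymm h h'.1)
  rw [Set.ofPred_true, probReal_univ, real_charDisc_pos] at h
  linarith

lemma toMatrix_neg (x : MatrixSpace) : toMatrix (-x) = -toMatrix x := rfl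

lemma real_repeller_eq_attractor : (stdGaussian MatrixSpace).real
    {x | 0 < (toMatrix x).det ∧ 0 < (toMatrix x).trace} =
    (stdGaussian MatrixSpace).real {x | 0 < (toMatrix x).det ∧ (toMatrix x).trace < 0} := by
  have h1 : {x | 0 < (toMatrix x).det ∧ (toMatrix x).trace < 0} =
      (LinearIsometryEquiv.neg ℝ : MatrixSpace ≃ₗᵢ[ℝ] MatrixSpace) ⁻¹'
        {x | 0 < (toMatrix x).det ∧ 0 < (toMatrix x).trace} := by
    ext x
    simp [toMatrix_neg, det_neg_two, Matrix.trace_neg]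
  have h2 : MeasurableSet {x | 0 < (toMatrix x).det ∧ 0 < (toMatrix x).trace} :=
    (measurableSet_lt measurable_const measurable_det_toMatrix).inter
      (measurableSet_lt measurable_const measurable_trace_toMatrix)
  rw [measureReal_def, measureReal_def, h1, stdGaussian_preimage _ h2]

/-- Changing the sign of the matrix keeps det and reverses tr, so {det > 0}, of probability 1/2,
splits evenly up to a null set. -/
lemma real_attractor : (stdGaussian MatrixSpace).real
    {x | 0 < (toMatrix x).det ∧ (toMatrix x).trace < 0} = 1 / 4 := by
  have h := measureReal_eq_add_of_ae (μ := stdGaussian MatrixSpace)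
    (r := fun x => 0 < (toMatrix x).det)
    (p := fun x => 0 < (toMatrix x).det ∧ (toMatrix x).trace < 0)
    (q := fun x => 0 < (toMatrix x).det ∧ 0 < (toMatrix x).trace)
    ((measurableSet_lt measurable_const measurable_det_toMatrix).inter
      (measurableSet_lt measurable_const measurable_trace_toMatrix))
    (ae_trace_ne_zero.mono fun x hx => ⟨fun h => hx.lt_or_gt.imp (fun h' => ⟨h, h'⟩)
      fun h' => ⟨h, h'⟩, fun h => h.elim And.left And.left⟩)
    (fun x h h' => lt_asymm h.2 h'.2)
  rw [real_repeller_eq_attractor, real_det_pos] at h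
  linarith

/-! ### The random field -/

lemma hasLaw_toLp_stdGaussian {Ω : Type*} [MeasurableSpace Ω] {P : Measure Ω}
    [IsProbabilityMeasure P] {X : Fin 2 → Fin 2 → Ω → ℝ}
    (hlaw : ∀ i j, HasLaw (X i j) (gaussianReal 0 1) P)
    (hindep : iIndepFun (fun p : Fin 2 × Fin 2 => X p.1 p.2) P) :
    HasLaw (fun ω => (WithLp.toLp 2 fun p : Fin 2 × Fin 2 => X p.1 p.2 ω : MatrixSpace))
      (stdGaussian MatrixSpace) P := by
  have hX : ∀ p : Fin 2 × Fin 2, AEMeasurable (X p.1 p.2) P :=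
    fun p => (hlaw p.1 p.2).aemeasurable
  have hvec : AEMeasurable (fun ω (p : Fin 2 × Fin 2) => X p.1 p.2 ω) P :=
    aemeasurable_pi_lambda _ hX
  have hL : Measurable (WithLp.toLp 2 : (Fin 2 × Fin 2 → ℝ) → MatrixSpace) := by fun_prop
  refine ⟨hL.comp_aemeasurable hvec, ?_⟩
  have h1 : P.map (fun ω (p : Fin 2 × Fin 2) => X p.1 p.2 ω) =
      Measure.pi fun _ : Fin 2 × Fin 2 => gaussianReal 0 1 := by
    rw [(iIndepFun_iff_map_fun_eq_pi_map hX).1 hindep]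
    congr 1
    exact funext fun p => (hlaw p.1 p.2).map_eq
  rw [← map_pi_eq_stdGaussian, ← h1, AEMeasurable.map_map_of_aemeasurable hL.aemeasurable hvec]
  rfl

lemma LinearPortrait.measurableSet_realizes (L : LinearPortrait) :
    MeasurableSet {x | L.Realizes (toMatrix x)} := by
  cases L with
  | saddle => exact measurableSet_lt measurable_det_toMatrix measurable_const
  | node =>
    exact (measurableSet_lt measurable_const measurable_det_toMatrix).inter
      (measurableSet_lt measurable_const measurable_charDisc_toMatrix)
  | focus =>
    exact (measurableSet_lt measurable_charDisc_toMatrix measurable_const).inter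
      (measurable_trace_toMatrix (measurableSet_singleton 0).compl)

lemma LinearPortrait.real_realizes_pos (L : LinearPortrait) :
    0 < (stdGaussian MatrixSpace).real {x | L.Realizes (toMatrix x)} := by
  have h1 : 1 < √2 := Real.lt_sqrt_of_sq_lt (by norm_num)
  have h2 : √2 < 2 := (Real.sqrt_lt' two_pos).2 (by norm_num)
  cases L with
  | saddle => exact real_det_neg.symm ▸ (by norm_num)
  | node => exact real_node.symm ▸ (by linarith)
  | focus => exact real_focus.symm ▸ (by linarith)

theorem theorem1 {Ω : Type*} [MeasurableSpace Ω] (P : Measure Ω) [IsProbabilityMeasure P]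
    (X : Fin 2 → Fin 2 → Ω → ℝ)
    (hlaw : ∀ i j, HasLaw (X i j) (gaussianReal 0 1) P)
    (hindep : iIndepFun (fun p : Fin 2 × Fin 2 => X p.1 p.2) P) :
    -- the three portraits are different, and they are exactly those of positive probability
    (∀ L L' : LinearPortrait, HasPortrait (linearField L.model) L' → L = L') ∧
    (∀ c : Matrix (Fin 2) (Fin 2) ℝ,
      PositiveProbability P X (linearField c) ↔ ∃ L, HasPortrait (linearField c) L) ∧
    -- the portraits of positive probability are determined by (index, number of invariant lines)
    (∀ c c' : Matrix (Fin 2) (Fin 2) ℝ,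
      PositiveProbability P X (linearField c) → PositiveProbability P X (linearField c') →
        (SamePortrait (linearField c) (linearField c') ↔
          ∃ (i : ℤ) (l : ℕ), HasCouple (linearField c) i l ∧ HasCouple (linearField c') i l)) ∧
    (∀ c : Matrix (Fin 2) (Fin 2) ℝ, PositiveProbability P X (linearField c) →
      (HasPortrait (linearField c) .saddle ↔ HasCouple (linearField c) (-1) 2) ∧
      (HasPortrait (linearField c) .node ↔ HasCouple (linearField c) 1 2) ∧
      (HasPortrait (linearField c) .focus ↔ HasCouple (linearField c) 1 0)) ∧
    -- the probabilities of the three portraits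
    (∀ L, NullMeasurableSet {ω | HasPortrait (randomField X ω) L} P) ∧
    P.real {ω | HasPortrait (randomField X ω) .saddle} = 1 / 2 ∧
    P.real {ω | HasPortrait (randomField X ω) .node} = √2 / 2 - 1 / 2 ∧
    P.real {ω | HasPortrait (randomField X ω) .focus} = 1 - √2 / 2 ∧
    -- global attractors and repellers
    NullMeasurableSet {ω | IsGlobalAttractor (randomField X ω)} P ∧
    P.real {ω | IsGlobalAttractor (randomField X ω)} = 1 / 4 ∧
    NullMeasurableSet {ω | IsGlobalRepeller (randomField X ω)} P ∧
    P.real {ω | IsGlobalRepeller (randomField X ω)} = 1 / 4 := by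
  have hlawV := hasLaw_toLp_stdGaussian hlaw hindep
  set V : Ω → MatrixSpace := fun ω => WithLp.toLp 2 fun p : Fin 2 × Fin 2 => X p.1 p.2 ω with hV
  have hfield : ∀ ω, randomField X ω = linearField (toMatrix (V ω)) := fun ω => rfl
  have hmeas : ∀ {s : Set MatrixSpace}, MeasurableSet s → NullMeasurableSet (V ⁻¹' s) P :=
    fun hs => hlawV.aemeasurable.nullMeasurable hs
  have hreal : ∀ {s : Set MatrixSpace}, MeasurableSet s →
      P.real (V ⁻¹' s) = (stdGaussian MatrixSpace).real s := fun hs => by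
    rw [measureReal_def, measureReal_def, ← hlawV.map_eq,
      Measure.map_apply_of_aemeasurable hlawV.aemeasurable hs]
  have hae : ∀ {p : MatrixSpace → Prop}, (∀ᵐ x ∂(stdGaussian MatrixSpace), p x) →
      ∀ᵐ ω ∂P, p (V ω) := fun hp =>
    ae_of_ae_map hlawV.aemeasurable (hlawV.map_eq.symm ▸ hp)
  have hdet := hae ae_det_ne_zero
  have hdisc := hae ae_charDisc_ne_zero
  have htr := hae ae_trace_ne_zero
  have hset : ∀ L : LinearPortrait, {ω | HasPortrait (randomField X ω) L} =
      V ⁻¹' {x | L.Realizes (toMatrix x)} := fun L => by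
    ext ω
    exact hasPortrait_iff
  have hattr : {ω | IsGlobalAttractor (randomField X ω)} =ᵐ[P]
      V ⁻¹' {x | 0 < (toMatrix x).det ∧ (toMatrix x).trace < 0} := by
    filter_upwards [hdet, hdisc] with ω h1 h2
    exact propext (isGlobalAttractor_iff h1 h2)
  have hrep : {ω | IsGlobalRepeller (randomField X ω)} =ᵐ[P]
      V ⁻¹' {x | 0 < (toMatrix x).det ∧ 0 < (toMatrix x).trace} := by
    filter_upwards [hdet, hdisc] with ω h1 h2
    exact propext (isGlobalRepeller_iff h1 h2)
  have hattrm : MeasurableSet {x | 0 < (toMatrix x).det ∧ (toMatrix x).trace < 0} :=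
    (measurableSet_lt measurable_const measurable_det_toMatrix).inter
      (measurableSet_lt measurable_trace_toMatrix measurable_const)
  have hrepm : MeasurableSet {x | 0 < (toMatrix x).det ∧ 0 < (toMatrix x).trace} :=
    (measurableSet_lt measurable_const measurable_det_toMatrix).inter
      (measurableSet_lt measurable_const measurable_trace_toMatrix)
  have hpos : ∀ c : Matrix (Fin 2) (Fin 2) ℝ,
      PositiveProbability P X (linearField c) ↔ ∃ L, HasPortrait (linearField c) L := by
    intro c
    constructor
    · intro h
      by_contra hno
      -- At a nondegenerate ω the random field has one of the three portraits, and c would share it;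
      -- so the event lies in the null set of degenerate matrices.
      refine h.ne' (measure_mono_null (t := {ω | ¬((toMatrix (V ω)).det ≠ 0 ∧
        charDisc (toMatrix (V ω)) ≠ 0 ∧ (toMatrix (V ω)).trace ≠ 0)}) (fun ω hω hgen => hno ?_) ?_)
      · obtain ⟨L, hL⟩ := exists_realizes hgen.1 hgen.2.1 hgen.2.2
        exact ⟨L, (SamePortrait.symm hω).trans hL.hasPortrait⟩
      · exact ae_iff.1 (hdet.and (hdisc.and htr))
    · rintro ⟨L, hL⟩
      have h1 : 0 < P {ω | HasPortrait (randomField X ω) L} := by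
        have h2 := hreal L.measurableSet_realizes
        rw [← hset] at h2
        have h3 := h2 ▸ L.real_realizes_pos
        exact pos_iff_ne_zero.2 fun h0 => by simp [measureReal_def, h0] at h3
      refine h1.trans_le (measure_mono fun ω hω => ?_)
      exact SamePortrait.trans hω hL.symm
  refine ⟨fun L L' h => L.realizes_model.unique (hasPortrait_iff.1 h), hpos, ?_, ?_, ?_, ?_, ?_,
    ?_, ?_, ?_, ?_, ?_⟩
  · intro c c' hc hc'
    obtain ⟨L, hL⟩ := (hpos c).1 hc
    obtain ⟨L', hL'⟩ := (hpos c').1 hc'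
    exact (hasPortrait_iff.1 hL).samePortrait_iff (hasPortrait_iff.1 hL')
  · intro c hc
    obtain ⟨L, hL⟩ := (hpos c).1 hc
    have h := (hasPortrait_iff.1 hL).hasPortrait_iff_hasCouple
    exact ⟨h .saddle, h .node, h .focus⟩
  · intro L
    rw [hset]
    exact hmeas L.measurableSet_realizes
  · rw [hset, hreal (LinearPortrait.measurableSet_realizes _)]
    exact real_det_neg
  · rw [hset, hreal (LinearPortrait.measurableSet_realizes _)]
    exact real_node
  · rw [hset, hreal (LinearPortrait.measurableSet_realizes _)]
    exact real_focus
  · exact (hmeas hattrm).congr hattr.symm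
  · rw [measureReal_congr hattr, hreal hattrm, real_attractor]
  · exact (hmeas hrepm).congr hrep.symm
  · rw [measureReal_congr hrep, hreal hrepm, real_repeller_eq_attractor, real_attractor]
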